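/- All graphs are finite, simple and undirected. A graph $G$ is a \emph{unigraph} if every graph with the same multiset of vertex degrees as $G$ is isomorphic to $G$. For an edge coloring $c\colon E(G)\to\{1,\dots,k\}$ (not necessarily proper, $k\ge 0$), the color-$i$ subgraph has as edges the edges of color $i$ and as vertices their endpoints. The \emph{unigraph number} $w(G)$ is the minimum $k$ for which there is a coloring $c\colon E(G)\to\{1,\dots,k\}$ such that, for every $i\in\{1,\dots,k\}$, the color-$i$ subgraph is a connected unigraph (the graph without vertices does not count as connected). The \emph{edge domination number} of $G$ is the minimum size of a set $D\subseteq E(G)$ such that every edge of $E(G)\setminus D$ shares an endpoint with some edge of $D$. \textbf{Theorem.} For every tree $T$, the unigraph number $w(T)$ (the minimum is attained) equals the edge domination number of $T$. Moreover, there is an algorithm that computes it in linear time: there are a program $P$ for the unit-cost word RAM (with addition, truncated subtraction, comparison and indirect addressing) and a constant $C$ such that, for every $n$, every tree $T$ on the vertex set $\{0,\dots,n-1\}$, and every list of the edges of $T$ (in any order, each edge once, its endpoints in either order) given as input together with $n$, the program $P$, run with words of $C\cdot b(n)$ bits, where $b(n)=\lfloor\log_2 n\rfloor+1$, halts after at most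 $C n$ steps with output $w(T)$. -/

import Mathlib

namespace SimpleGraph

variable {V : Type*}

open Classical in
/-- The degree set of a finite graph: the multiset of the degrees of all its vertices. -/
noncomputable def degreeSet [Finite V] (G : SimpleGraph V) : Multiset ℕ :=
  letI := Fintype.ofFinite V
  (Finset.univ : Finset V).val.map fun v => G.degree v

/-- A finite graph `G` is a unigraph if every finite graph `H` (connected or not) with the same
degree set is isomorphic to `G`. Every finite graph is isomorphic to one with vertex type in
`Type`, so nothing is lost by taking `H` there. -/
def IsUnigraph [Finite V] (G : SimpleGraph V) : Prop :=
  ∀ (W : Type) [Finite W] (H : SimpleGraph W), H.degreeSet = G.degreeSet → Nonempty (G ≃g H)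

/-- The edge-induced subgraph `G[F]`: its edges are those in `F`, its vertices are the endpoints
of the edges in `F`. -/
def edgeInduced (G : SimpleGraph V) (F : Set G.edgeSet) : G.Subgraph where
  verts := {v | ∃ e ∈ F, v ∈ (e : Sym2 V)}
  Adj u v := ∃ h : s(u, v) ∈ G.edgeSet, (⟨s(u, v), h⟩ : G.edgeSet) ∈ F
  adj_sub := fun ⟨h, _⟩ => h
  edge_vert := fun ⟨_, h⟩ => ⟨_, h, Sym2.mem_mk_left _ _⟩
  symm := ⟨fun u v ⟨h, hF⟩ => by
    have e : s(u, v) = s(v, u) := Sym2.eq_swap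
    exact ⟨e ▸ h, by simpa only [← e] using hF⟩⟩

/-- The color-`i` subgraph of `G` under the (not necessarily proper) `k`-edge coloring `c`. -/
def colorSubgraph (G : SimpleGraph V) {k : ℕ} (c : G.edgeSet → Fin k) (i : Fin k) : G.Subgraph :=
  G.edgeInduced {e | c e = i}

/-- `c` is a `k`-unigraphic coloring: each of the `k` color subgraphs is a connected unigraph
(in particular each color is used: the graph without vertices is not connected). -/
def IsUnigraphicColoring [Finite V] (G : SimpleGraph V) {k : ℕ} (c : G.edgeSet → Fin k) : Prop :=
  ∀ i, (G.colorSubgraph c i).coe.Connected ∧ (G.colorSubgraph c i).coe.IsUnigraph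

/-- `G` is a `k`-unigraph. The value `k = 0` is possible exactly for graphs without edges. -/
def IsKUnigraph [Finite V] (G : SimpleGraph V) (k : ℕ) : Prop :=
  ∃ c : G.edgeSet → Fin k, G.IsUnigraphicColoring c

/-- The unigraph number: the minimum `k` such that `G` is a `k`-unigraph. -/
noncomputable def unigraphNumber [Finite V] (G : SimpleGraph V) : ℕ :=
  sInf {k | G.IsKUnigraph k}

/-- `D` is an edge dominating set of `G`: every edge outside `D` shares an endpoint with an edge
in `D`. -/
def IsEdgeDominating (G : SimpleGraph V) (D : Set (Sym2 V)) : Prop :=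
  D ⊆ G.edgeSet ∧ ∀ e ∈ G.edgeSet \ D, ∃ e' ∈ D, ∃ v, v ∈ e' ∧ v ∈ e

/-- The edge domination number: the minimum size of an edge dominating set. -/
noncomputable def edgeDominationNumber (G : SimpleGraph V) : ℕ :=
  sInf {k | ∃ D : Finset (Sym2 V), G.IsEdgeDominating (D : Set (Sym2 V)) ∧ D.card = k}

/-- `l` is an edge list of `G`: it lists every edge of `G` exactly once, in any order and each
with its two endpoints in either order. -/
def IsEdgeList (G : SimpleGraph V) (l : List (V × V)) : Prop :=
  (l.map fun p => s(p.1, p.2)).Nodup ∧ ∀ e, e ∈ (l.map fun p => s(p.1, p.2)) ↔ e ∈ G.edgeSet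

end SimpleGraph

/-! ### Word RAM with unit costs -/

namespace WordRAM

/-- Programs of a random access machine. Registers `x y z` and memory arrays `a` are named by
natural numbers; a program is a finite text, so it names only finitely many of them. -/
inductive Prog : Type
  /-- do nothing -/
  | skip : Prog
  /-- `x := k` -/
  | const (x k : ℕ) : Prog
  /-- `x := y + z` -/
  | add (x y z : ℕ) : Prog
  /-- `x := y - z`, truncated at `0` -/
  | sub (x y z : ℕ) : Prog
  /-- `x := a[y]` -/
  | load (x a y : ℕ) : Prog
  /-- `a[y] := z` -/
  | store (a y z : ℕ) : Prog
  /-- `p; q` -/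
  | seq (p q : Prog) : Prog
  /-- `if x < y then p else q` -/
  | ifLt (x y : ℕ) (p q : Prog) : Prog
  /-- `while x < y do p` -/
  | whileLt (x y : ℕ) (p : Prog) : Prog

/-- Contents of the registers and of the memory cells (array `a`, address `i`). -/
structure State : Type where
  reg : ℕ → ℕ
  mem : ℕ → ℕ → ℕ

/-- Write `v` into register `x`. -/
def State.setReg (s : State) (x v : ℕ) : State :=
  { s with reg := Function.update s.reg x v }

/-- Write `v` into the cell of array `a` at address `i`. -/
def State.setMem (s : State) (a i v : ℕ) : State :=
  { s with mem := Function.update s.mem a (Function.update (s.mem a) i v) }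

/-- `Exec b p s t s'`: on a machine with words of `b` bits, program `p` started in state `s` halts
in state `s'` after exactly `t` steps. Every elementary instruction and every evaluation of a test
is one step. An instruction whose result does not fit into a word has no execution. -/
inductive Exec (b : ℕ) : Prog → State → ℕ → State → Prop
  | skip (s) : Exec b .skip s 1 s
  | const (s x k) (h : k < 2 ^ b) : Exec b (.const x k) s 1 (s.setReg x k)
  | add (s x y z) (h : s.reg y + s.reg z < 2 ^ b) :
      Exec b (.add x y z) s 1 (s.setReg x (s.reg y + s.reg z))
  | sub (s x y z) (h : s.reg y - s.reg z < 2 ^ b) :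
      Exec b (.sub x y z) s 1 (s.setReg x (s.reg y - s.reg z))
  | load (s x a y) (h : s.mem a (s.reg y) < 2 ^ b) :
      Exec b (.load x a y) s 1 (s.setReg x (s.mem a (s.reg y)))
  | store (s a y z) (h : s.reg z < 2 ^ b) :
      Exec b (.store a y z) s 1 (s.setMem a (s.reg y) (s.reg z))
  | seq {p q s t s' t' s''} (hp : Exec b p s t s') (hq : Exec b q s' t' s'') :
      Exec b (.seq p q) s (t + t') s''
  | ifTrue {x y p q s t s'} (h : s.reg x < s.reg y) (hp : Exec b p s t s') :
      Exec b (.ifLt x y p q) s (t + 1) s'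
  | ifFalse {x y p q s t s'} (h : ¬ s.reg x < s.reg y) (hq : Exec b q s t s') :
      Exec b (.ifLt x y p q) s (t + 1) s'
  | whileTrue {x y p s t s' t' s''} (h : s.reg x < s.reg y) (hp : Exec b p s t s')
      (hw : Exec b (.whileLt x y p) s' t' s'') : Exec b (.whileLt x y p) s (t + t' + 1) s''
  | whileFalse {x y p s} (h : ¬ s.reg x < s.reg y) : Exec b (.whileLt x y p) s 1 s

/-- The initial state for a graph on the vertices `0, …, n - 1` given by a list of edges: register
`0` holds `n`, and arrays `0` and `1` hold at address `j` the two endpoints of the `j`-th edge. All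
other registers and cells are `0`. -/
def input (n : ℕ) (l : List (Fin n × Fin n)) : State where
  reg x := if x = 0 then n else 0
  mem a j :=
    if a = 0 then (l.map fun p => (p.1 : ℕ)).getD j 0
    else if a = 1 then (l.map fun p => (p.2 : ℕ)).getD j 0
    else 0

end WordRAM

/-! ### Degree-preserving switches and trees that are unigraphs. -/

namespace SimpleGraph

/-! A tree with an edge is a unigraph exactly when some edge meets all its edges. If a tree contains
a path `w v u x y`, replacing the edges `wv`, `xy` by `wy`, `vx` keeps all degrees but creates the
triangle `v u x`; so a unigraph tree has no path with four edges, and an edge with maximal degree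
sum then meets every edge (`IsUnigraph.exists_isDominatingEdge`). Conversely such a tree is a double
star, and a double star is recognized by its degrees: two centers whose degrees sum to the order,
all other degrees equal to one (`IsDoubleStar.isUnigraph`). Hence a unigraphic coloring of a forest
gives an edge dominating set with one edge per color, and an edge dominating set gives a coloring by
sending every edge to a chosen edge that it touches (`IsAcyclic.isKUnigraph_iff`).

The algorithm strips leaves greedily. A vertex is free (`0`), has to be covered (`1`) or is covered
(`2`). A covered leaf is dropped; a free leaf passes the duty to cover its edge on to its neighbor;
a leaf that has to be covered forces a choice, for which its edge to its neighbor is best (the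
lemmas `partialDominationNumber_of_leaf_*`). Linear time needs no adjacency lists: the degree and
the sum of the neighbors of each vertex suffice, because for a leaf that sum is its only neighbor. A
scan visits the vertices in order and, after a deletion, follows the neighbor, the only vertex that
can have become a leaf. Each round advances the scan or removes an edge. -/

theorem degreeSet_eq_map {V : Type*} [Fintype V] (G : SimpleGraph V) :
    G.degreeSet = (Finset.univ : Finset V).val.map fun v => (G.neighborSet v).ncard := by
  classical
  unfold degreeSet
  refine Multiset.map_congr (by congr!) fun v _ => ?_
  rw [← card_neighborFinset_eq_degree, ← Set.ncard_coe_finset, coe_neighborFinset]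

theorem degreeSet_eq_iff {V W : Type*} [Finite V] [Finite W] (G : SimpleGraph V)
    (H : SimpleGraph W) :
    H.degreeSet = G.degreeSet ↔
      ∃ φ : V ≃ W, ∀ v, (H.neighborSet (φ v)).ncard = (G.neighborSet v).ncard := by
  classical
  let := Fintype.ofFinite V
  let := Fintype.ofFinite W
  rw [degreeSet_eq_map, degreeSet_eq_map]
  constructor
  · intro h
    have key : ∀ d, Nonempty ({v // (G.neighborSet v).ncard = d} ≃
        {w // (H.neighborSet w).ncard = d}) := by
      intro d
      refine ⟨Fintype.equivOfCardEq ?_⟩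
      -- Equal multisets have equal multiplicities, so the vertices of degree `d` match up in number
      -- for every `d`; the bijections are glued below.
      have := congrArg (Multiset.count d) h
      rw [Multiset.count_map, Multiset.count_map] at this
      rw [Fintype.card_subtype, Fintype.card_subtype, Finset.card_def, Finset.card_def,
        Finset.filter_val, Finset.filter_val]
      simpa only [eq_comm] using this.symm
    exact ⟨Equiv.ofFiberEquiv fun d => (key d).some, 
      fun v => Equiv.ofFiberEquiv_map (g := fun w => (H.neighborSet w).ncard) _ v⟩
  · rintro ⟨φ, hφ⟩
    rw [← Multiset.map_univ_val_equiv φ, Multiset.map_map]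
    exact Multiset.map_congr rfl fun v _ => hφ v

theorem Iso.degreeSet_eq {V W : Type*} [Finite V] [Finite W] {G : SimpleGraph V}
    {H : SimpleGraph W} (e : G ≃g H) : H.degreeSet = G.degreeSet := by
  refine (degreeSet_eq_iff G H).2 ⟨e.toEquiv, fun v => ?_⟩
  rw [← Nat.card_coe_set_eq, ← Nat.card_coe_set_eq]
  exact (Nat.card_congr (e.mapNeighborSet v)).symm

/-- Being a unigraph also controls the graphs on vertex types in other universes. -/
theorem IsUnigraph.nonempty_iso {V W : Type*} [Finite V] [Finite W] {G : SimpleGraph V}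
    (hG : G.IsUnigraph) {H : SimpleGraph W} (h : H.degreeSet = G.degreeSet) :
    Nonempty (G ≃g H) := by
  obtain ⟨n, ⟨e⟩⟩ := Finite.exists_equiv_fin W
  let f := Iso.map e H
  obtain ⟨g⟩ := hG (Fin n) (H.map e.toEmbedding) (f.degreeSet_eq.trans h)
  exact ⟨g.trans f.symm⟩

/-- The edges `a b` and `c d` are replaced by `a d` and `b c`. -/
def switch {V : Type*} [DecidableEq V] (G : SimpleGraph V) (a b c d : V) : SimpleGraph V :=
  (G.deleteEdges {s(a, b), s(c, d)}) ⊔ edge a d ⊔ edge b c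

/-- Each new neighborhood is the image of the old one under a transposition: `a` and `c` exchange
`b` with `d`, while `b` and `d` exchange `a` with `c`. -/
theorem degreeSet_switch {V : Type*} [Finite V] [DecidableEq V] (G : SimpleGraph V) {a b c d : V}
    (hab : G.Adj a b) (hcd : G.Adj c d) (had : ¬ G.Adj a d) (hbc : ¬ G.Adj b c)
    (ne_ac : a ≠ c) (ne_ad : a ≠ d) (ne_bc : b ≠ c) (ne_bd : b ≠ d) :
    (G.switch a b c d).degreeSet = G.degreeSet := by
  refine (degreeSet_eq_iff _ _).2 ⟨Equiv.refl V, fun v => ?_⟩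
  let σ : Equiv.Perm V := if v = a ∨ v = c then Equiv.swap b d else
    if v = b ∨ v = d then Equiv.swap a c else 1
  have hσ : (G.switch a b c d).neighborSet v = σ '' G.neighborSet v := by
    ext w
    rw [Equiv.image_eq_preimage_symm]
    have h1 := hab.ne
    have h2 := hcd.ne
    have h3 := hab.symm
    have h4 := hcd.symm
    have h5 := fun h => had (Adj.symm h)
    have h6 := fun h => hbc (Adj.symm h)
    simp only [switch, mem_neighborSet, sup_adj, deleteEdges_adj, edge_adj, Set.mem_insert_iff,
      Set.mem_singleton_iff, Sym2.eq_iff, Set.mem_preimage]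
    by_cases hva : v = a ∨ v = c
    · simp only [σ, if_pos hva, Equiv.symm_swap, Equiv.swap_apply_def]
      grind
    · by_cases hvb : v = b ∨ v = d
      · simp only [σ, if_neg hva, if_pos hvb, Equiv.symm_swap, Equiv.swap_apply_def]
        grind
      · simp only [σ, if_neg hva, if_neg hvb]
        rw [show (1 : Equiv.Perm V).symm w = w from rfl]
        grind
  rw [Equiv.refl_apply, hσ, Set.ncard_image_of_injective _ σ.injective]

theorem IsAcyclic.not_adj_of_adj_of_adj {V : Type*} {G : SimpleGraph V} (hG : G.IsAcyclic)
    {u v w : V} (huv : G.Adj u v) (hvw : G.Adj v w) : ¬ G.Adj u w := by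
  classical
  intro huw
  exact hG.cliqueFree le_rfl {u, v, w} (is3Clique_triple_iff.2 ⟨huv, huw, hvw⟩)

/-- `u v` is an edge that shares an endpoint with every edge of `G`. -/
structure IsDominatingEdge {V : Type*} (G : SimpleGraph V) (u v : V) : Prop where
  adj : G.Adj u v
  mem_or_mem : ∀ x y, G.Adj x y → x = u ∨ x = v ∨ y = u ∨ y = v

/-- An edge with maximal degree sum works: an edge `xy` not meeting it but hanging on it at `u`
gives `x` degree at least two, so by maximality the other end `v` also has a second neighbor, and a
path with four edges arises. -/
theorem IsUnigraph.exists_isDominatingEdge {V : Type*} [Finite V] {G : SimpleGraph V}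
    (hu : G.IsUnigraph) (hG : G.IsTree) (hne : ∃ u v, G.Adj u v) :
    ∃ u v, G.IsDominatingEdge u v := by
  classical
  let := Fintype.ofFinite V
  have hac := hG.isAcyclic
  -- a path with four edges could be switched to create a triangle
  have noPath : ∀ w v u x y, G.Adj w v → G.Adj v u → G.Adj u x → G.Adj x y →
      w ≠ u → v ≠ x → u ≠ y → False := by
    intro w v u x y hwv hvu hux hxy h1 h2 h3
    have hvx := hac.not_adj_of_adj_of_adj hvu hux
    have hne1 : w ≠ x := by rintro rfl; exact hvx hwv.symm
    have hne2 : v ≠ y := by rintro rfl; exact hvx hxy.symm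
    have hp1 : (Walk.cons hwv (.cons hvu (.cons hux .nil))).IsPath := by
      simp [hwv.ne, hvu.ne, hux.ne, h1, h2, hne1]
    -- Paths between two vertices of a forest are unique, and these two have different lengths.
    have hne3 : w ≠ y := by
      rintro rfl
      have := congrArg (fun p : G.Path w x => p.1.length)
        ((hac.subsingleton_path w x).elim ⟨_, hp1⟩ ⟨_, (Path.singleton hxy.symm).2⟩)
      simp [Path.singleton] at this
    have hp2 : (Walk.cons hwv (.cons hvu (.cons hux (.cons hxy .nil)))).IsPath := by
      simp [hwv.ne, hvu.ne, hux.ne, hxy.ne, h1, h2, h3, hne1, hne2, hne3]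
    have hwy : ¬ G.Adj w y := by
      intro hwy
      have := congrArg (fun p : G.Path w y => p.1.length)
        ((hac.subsingleton_path w y).elim ⟨_, hp2⟩ ⟨_, (Path.singleton hwy).2⟩)
      simp [Path.singleton] at this
    have hd := G.degreeSet_switch hwv hxy hwy hvx hne1 hne3 h2 hne2
    obtain ⟨e⟩ := hu.nonempty_iso hd
    have hac' := (e.isAcyclic_iff).1 hac
    have a1 : (G.switch w v x y).Adj v u := by
      simp only [switch, sup_adj, deleteEdges_adj, edge_adj, Set.mem_insert_iff,
        Set.mem_singleton_iff, Sym2.eq_iff]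
      grind
    have a2 : (G.switch w v x y).Adj u x := by
      simp only [switch, sup_adj, deleteEdges_adj, edge_adj, Set.mem_insert_iff,
        Set.mem_singleton_iff, Sym2.eq_iff]
      grind
    have a3 : (G.switch w v x y).Adj v x := by
      simp only [switch, sup_adj, deleteEdges_adj, edge_adj, Set.mem_insert_iff,
        Set.mem_singleton_iff, Sym2.eq_iff]
      grind
    exact hac'.not_adj_of_adj_of_adj a1 a2 a3
  obtain ⟨u₀, v₀, h₀⟩ := hne
  obtain ⟨⟨u, v⟩, huv, hmax⟩ := Finset.exists_max_image
    ((Finset.univ : Finset (V × V)).filter fun p => G.Adj p.1 p.2)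
    (fun p => G.degree p.1 + G.degree p.2) ⟨(u₀, v₀), by simp [h₀]⟩
  simp only [Finset.mem_filter, Finset.mem_univ, true_and, Prod.forall] at huv hmax
  -- no edge at distance one from the chosen edge
  have step : ∀ u v x y, G.Adj u v → (∀ a b, G.Adj a b → G.degree a + G.degree b ≤
      G.degree u + G.degree v) → G.Adj u x → x ≠ v → G.Adj x y → y = u := by
    intro u v x y huv hmax hux hxv hxy
    by_contra hyu
    have hdx : 2 ≤ G.degree x := by
      rw [← card_neighborFinset_eq_degree]
      exact Finset.one_lt_card.2 ⟨u, by simpa using hux.symm, y, by simpa using hxy, Ne.symm hyu⟩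
    have hdv : 1 < G.degree v := by have := hmax u x hux; omega
    rw [← card_neighborFinset_eq_degree] at hdv
    obtain ⟨w, hw, hwu⟩ := Finset.exists_mem_ne hdv u
    exact noPath w v u x y (by simpa using ((G.mem_neighborFinset _ _).1 hw).symm) huv.symm hux
      hxy hwu hxv.symm (Ne.symm hyu)
  refine ⟨u, v, huv, ?_⟩
  -- Walking from `u`, one never leaves the closed neighborhood of the edge, since by `step` a
  -- neighbor of an end leads only back to that end.
  have cover : ∀ x, x = u ∨ x = v ∨ G.Adj u x ∨ G.Adj v x := by
    intro x
    obtain ⟨p⟩ := hG.connected.preconnected u x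
    suffices ∀ a b (p : G.Walk a b), (a = u ∨ a = v ∨ G.Adj u a ∨ G.Adj v a) →
        (b = u ∨ b = v ∨ G.Adj u b ∨ G.Adj v b) from this _ _ p (Or.inl rfl)
    intro a b p
    induction p with
    | nil => exact id
    | @cons a c b hac' _ ih =>
      intro h
      apply ih
      rcases h with rfl | rfl | h | h
      · exact Or.inr (Or.inr (Or.inl hac'))
      · exact Or.inr (Or.inr (Or.inr hac'))
      · by_cases hav : a = v
        · subst hav; exact Or.inr (Or.inr (Or.inr hac'))
        · exact Or.inl (step u v a c huv hmax h hav hac')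
      · by_cases hau : a = u
        · subst hau; exact Or.inr (Or.inr (Or.inl hac'))
        · exact Or.inr (Or.inl (step v u a c huv.symm
            (fun a b hab => by rw [add_comm (G.degree v)]; exact hmax a b hab) h hau hac'))
  intro x y hxy
  by_contra! hcon
  obtain ⟨h1, h2, h3, h4⟩ := hcon
  rcases cover x with h | h | h | h
  · exact h1 h
  · exact h2 h
  · exact h3 (step u v x y huv hmax h h2 hxy)
  · exact h4 (step v u x y huv.symm
      (fun a b hab => by rw [add_comm (G.degree v)]; exact hmax a b hab) h h1 hxy)

end SimpleGraph

/-! ### Double stars, and the equality of the two numbers. -/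

namespace SimpleGraph

/-- `G` consists of the edge `u v` and of further leaves, each attached to `u` or to `v`. -/
structure IsDoubleStar {V : Type*} (G : SimpleGraph V) (u v : V) : Prop where
  adj_iff : ∀ x, G.Adj v x ↔ ¬ G.Adj u x
  mem_or_mem : ∀ x y, G.Adj x y → x = u ∨ x = v ∨ y = u ∨ y = v

namespace IsDoubleStar

variable {V : Type*} {G : SimpleGraph V} {u v : V}

/-- The neighborhoods of `u` and `v` are complementary, and `v` is not its own neighbor. -/
theorem adj (h : G.IsDoubleStar u v) : G.Adj u v := by
  have := h.adj_iff v
  simpa using this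

theorem connected (h : G.IsDoubleStar u v) : G.Connected := by
  have key : ∀ x, G.Reachable u x := by
    intro x
    by_cases hx : G.Adj u x
    · exact hx.reachable
    · exact h.adj.reachable.trans ((h.adj_iff x).2 hx).reachable
  have : Nonempty V := ⟨u⟩
  exact ⟨fun x y => (key x).symm.trans (key y)⟩

theorem ncard_neighborSet [Finite V] (h : G.IsDoubleStar u v) {x : V} (hu : x ≠ u) (hv : x ≠ v) :
    (G.neighborSet x).ncard = 1 := by
  rw [Set.ncard_eq_one]
  have h1 := h.adj_iff x
  have h2 := h.mem_or_mem x
  have h3 := G.adj_comm x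
  by_cases hx : G.Adj u x
  · exact ⟨u, by ext y; simp only [mem_neighborSet, Set.mem_singleton_iff]; grind⟩
  · exact ⟨v, by ext y; simp only [mem_neighborSet, Set.mem_singleton_iff]; grind⟩

theorem neighborSet_eq_compl (h : G.IsDoubleStar u v) : G.neighborSet v = (G.neighborSet u)ᶜ := by
  ext x
  exact h.adj_iff x

/-- A common neighbor of `u` and `v` would differ from both and so have degree one, a contradiction.
The two neighborhoods are thus disjoint, and by their sizes they fill `W`. -/
theorem of_neighborSet_ncard {W : Type*} [Finite W] {H : SimpleGraph W} {u v : W} (huv : u ≠ v)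
    (hcard : (H.neighborSet u).ncard + (H.neighborSet v).ncard = Nat.card W)
    (hleaf : ∀ x, x ≠ u → x ≠ v → (H.neighborSet x).ncard = 1) : H.IsDoubleStar u v := by
  have uniq : ∀ x, x ≠ u → x ≠ v → ∀ y z, H.Adj x y → H.Adj x z → y = z := by
    intro x hu hv y z hy hz
    obtain ⟨w, hw⟩ := Set.ncard_eq_one.1 (hleaf x hu hv)
    have hy' : y ∈ H.neighborSet x := hy
    have hz' : z ∈ H.neighborSet x := hz
    rw [hw] at hy' hz'
    exact hy'.trans hz'.symm
  have hdisj : Disjoint (H.neighborSet u) (H.neighborSet v) := by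
    rw [Set.disjoint_left]
    intro x hx hx'
    exact huv (uniq x hx.ne.symm hx'.ne.symm u v hx.symm hx'.symm)
  have hunion : H.neighborSet u ∪ H.neighborSet v = Set.univ := by
    exact Set.eq_of_subset_of_ncard_le (Set.subset_univ _) (by
      rw [Set.ncard_univ, Set.ncard_union_eq hdisj, hcard])
  have hadj : ∀ x, H.Adj v x ↔ ¬ H.Adj u x := by
    intro x
    refine ⟨fun h h' => Set.disjoint_left.1 hdisj h' h, fun h => ?_⟩
    have : x ∈ H.neighborSet u ∪ H.neighborSet v := hunion ▸ Set.mem_univ x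
    exact this.resolve_left h
  refine ⟨hadj, fun x y hxy => ?_⟩
  by_contra! hcon
  by_cases hx : H.Adj u x
  · exact hcon.2.2.1 (uniq x hcon.1 hcon.2.1 y u hxy hx.symm)
  · exact hcon.2.2.2 (uniq x hcon.1 hcon.2.1 y v hxy ((hadj x).2 hx).symm)

open Classical in
/-- The role of a vertex: one of the two centers, or a leaf attached to the one or the other. -/
noncomputable def role (G : SimpleGraph V) (u v x : V) : Fin 4 :=
  if x = u then 0 else if x = v then 1 else if G.Adj u x then 2 else 3

/-- Adjacency depends on the roles alone, so every bijection that preserves roles is an isomorphism.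
-/
theorem adj_iff_role (h : G.IsDoubleStar u v) (x y : V) :
    G.Adj x y ↔ (role G u v x, role G u v y) ∈
      ({(0, 1), (1, 0), (0, 2), (2, 0), (1, 3), (3, 1)} : Set (Fin 4 × Fin 4)) := by
  have h1 := h.adj
  have h2 := h.adj.symm
  have h3 := h.adj_iff x
  have h4 := h.adj_iff y
  have h5 := h.mem_or_mem x y
  have h6 := G.adj_comm x
  have h7 := h.adj.ne
  simp only [role, Set.mem_insert_iff, Set.mem_singleton_iff, Prod.mk.injEq]
  split_ifs <;> simp_all

/-- The role classes have sizes determined by the degrees of the centers; the subtraction of one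
takes out the other center. -/
theorem ncard_role [Finite V] (h : G.IsDoubleStar u v) (c : Fin 4) :
    Nat.card {x // role G u v x = c} =
      if c = 0 then 1 else if c = 1 then 1 else if c = 2 then (G.neighborSet u).ncard - 1 else
        (G.neighborSet v).ncard - 1 := by
  have h1 := h.adj
  have h2 := h.adj.ne
  change Nat.card ({x | role G u v x = c} : Set V) = _
  rw [Nat.card_coe_set_eq]
  fin_cases c
  · simp only [Fin.zero_eta, if_true]
    rw [Set.ncard_eq_one]
    refine ⟨u, ?_⟩
    ext x
    simp only [role, Set.mem_ofPred_eq, Set.mem_singleton_iff]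
    split_ifs <;> simp_all
  · simp only [Fin.mk_one, one_ne_zero, if_false, if_true]
    rw [Set.ncard_eq_one]
    refine ⟨v, ?_⟩
    ext x
    simp only [role, Set.mem_ofPred_eq, Set.mem_singleton_iff]
    split_ifs <;> simp_all
  · have : {x | role G u v x = 2} = G.neighborSet u \ {v} := by
      ext x
      simp only [role, Set.mem_ofPred_eq, Set.mem_sdiff, mem_neighborSet, Set.mem_singleton_iff]
      split_ifs <;> simp_all
    simp only [Fin.reduceFinMk, this, Fin.reduceEq, if_false, if_true]
    exact Set.ncard_sdiff_singleton_of_mem h1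
  · have : {x | role G u v x = 3} = G.neighborSet v \ {u} := by
      ext x
      have := h.adj_iff x
      simp only [role, Set.mem_ofPred_eq, Set.mem_sdiff, mem_neighborSet, Set.mem_singleton_iff]
      split_ifs <;> simp_all
    simp only [Fin.reduceFinMk, this, Fin.reduceEq, if_false]
    exact Set.ncard_sdiff_singleton_of_mem h1.symm

theorem isUnigraph [Finite V] (h : G.IsDoubleStar u v) : G.IsUnigraph := by
  intro W _ H hd
  obtain ⟨φ, hφ⟩ := (degreeSet_eq_iff G H).1 hd
  have hH : H.IsDoubleStar (φ u) (φ v) := by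
    refine of_neighborSet_ncard (φ.injective.ne h.adj.ne) ?_ ?_
    · rw [hφ, hφ, h.neighborSet_eq_compl, Set.ncard_add_ncard_compl]
      exact Nat.card_congr φ
    · intro x hu hv
      obtain ⟨x, rfl⟩ := φ.surjective x
      rw [hφ]
      exact h.ncard_neighborSet (fun h => hu (h ▸ rfl)) (fun h => hv (h ▸ rfl))
  have key : ∀ c, Nonempty ({x // role G u v x = c} ≃ {x // role H (φ u) (φ v) x = c}) := by
    intro c
    refine Finite.card_eq.1 ?_
    rw [h.ncard_role, hH.ncard_role, hφ, hφ]
  refine ⟨⟨Equiv.ofFiberEquiv fun c => (key c).some, ?_⟩⟩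
  intro x y
  have hr := Equiv.ofFiberEquiv_map (g := role H (φ u) (φ v)) fun c => (key c).some
  rw [hH.adj_iff_role, h.adj_iff_role, hr, hr]

end IsDoubleStar

theorem IsDominatingEdge.isDoubleStar {V : Type*} {G : SimpleGraph V} {u v : V}
    (h : G.IsDominatingEdge u v) (hG : G.IsAcyclic) (hiso : ∀ x, ∃ y, G.Adj x y) :
    G.IsDoubleStar u v := by
  refine ⟨fun x => ⟨fun hvx hux => hG.not_adj_of_adj_of_adj h.adj hvx hux, fun hux => ?_⟩,
    h.mem_or_mem⟩
  obtain ⟨y, hxy⟩ := hiso x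
  rcases h.mem_or_mem x y hxy with rfl | rfl | rfl | rfl
  · exact h.adj.symm
  · exact absurd h.adj hux
  · exact absurd hxy.symm hux
  · exact hxy.symm

theorem exists_adj_of_mem_colorSubgraph {V : Type*} {G : SimpleGraph V} {k : ℕ}
    (c : G.edgeSet → Fin k) (i : Fin k) (x : (G.colorSubgraph c i).verts) :
    ∃ y, (G.colorSubgraph c i).coe.Adj x y := by
  obtain ⟨x, ⟨e, he⟩, hc, hx⟩ := x
  obtain ⟨y, rfl⟩ := Sym2.mem_iff_exists.1 hx
  exact ⟨⟨y, ⟨_, he⟩, hc, Sym2.mem_mk_right _ _⟩, he, hc⟩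

/-- Color classes correspond to edges of a dominating set: a class has an edge meeting all of it,
and the edges assigned to one chosen edge form a double star around it. -/
theorem IsAcyclic.isKUnigraph_iff {V : Type*} [Finite V] {G : SimpleGraph V} (hG : G.IsAcyclic)
    (k : ℕ) :
    G.IsKUnigraph k ↔ ∃ D : Finset (Sym2 V), G.IsEdgeDominating (D : Set (Sym2 V)) ∧ D.card = k := by
  classical
  constructor
  · rintro ⟨c, hc⟩
    have key : ∀ i, ∃ d : G.edgeSet, c d = i ∧
        ∀ e : G.edgeSet, c e = i → ∃ x, x ∈ (d : Sym2 V) ∧ x ∈ (e : Sym2 V) := by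
      intro i
      obtain ⟨hcon, huni⟩ := hc i
      have := hcon.nonempty
      obtain ⟨x₀⟩ := this
      obtain ⟨u, v, huv⟩ := huni.exists_isDominatingEdge ⟨hcon, hG.subgraph _⟩
        ⟨x₀, exists_adj_of_mem_colorSubgraph c i x₀⟩
      obtain ⟨he, hi⟩ := huv.adj
      refine ⟨⟨_, he⟩, hi, ?_⟩
      rintro ⟨e, he'⟩ hei
      induction e using Sym2.ind with | _ x y => ?_
      have := huv.mem_or_mem ⟨x, ⟨_, he'⟩, hei, Sym2.mem_mk_left _ _⟩
        ⟨y, ⟨_, he'⟩, hei, Sym2.mem_mk_right _ _⟩ ⟨he', hei⟩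
      simp only [Subtype.ext_iff] at this
      simp only [Sym2.mem_iff]
      rcases this with h | h | h | h
      · exact ⟨x, Or.inl h, Or.inl rfl⟩
      · exact ⟨x, Or.inr h, Or.inl rfl⟩
      · exact ⟨y, Or.inl h, Or.inr rfl⟩
      · exact ⟨y, Or.inr h, Or.inr rfl⟩
    choose d hd hdom using key
    refine ⟨Finset.univ.image fun i => (d i : Sym2 V), ⟨?_, ?_⟩, ?_⟩
    · intro e he
      obtain ⟨i, -, rfl⟩ := Finset.mem_image.1 (Finset.mem_coe.1 he)
      exact (d i).2
    · rintro e ⟨he, -⟩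
      obtain ⟨x, hx⟩ := hdom _ ⟨e, he⟩ rfl
      exact ⟨_, by simp, x, hx⟩
    · rw [Finset.card_image_of_injective, Finset.card_univ, Fintype.card_fin]
      -- The edge `d i` has color `i`, so different colors give different edges.
      intro i j hij
      rw [← hd i, ← hd j, Subtype.ext hij]
  · rintro ⟨D, ⟨hsub, hdom⟩, rfl⟩
    -- Edges of `D` are assigned to themselves, so each class is nonempty and contains the edge that
    -- dominates it.
    have key : ∀ e : G.edgeSet, ∃ d : D, ((e : Sym2 V) ∈ D → (d : Sym2 V) = e) ∧
        ∃ x, x ∈ (d : Sym2 V) ∧ x ∈ (e : Sym2 V) := by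
      rintro ⟨e, he⟩
      by_cases heD : e ∈ D
      · refine ⟨⟨e, heD⟩, fun _ => rfl, ?_⟩
        induction e using Sym2.ind with | _ x y => exact ⟨x, by simp⟩
      · obtain ⟨d, hd, x, hx⟩ := hdom e ⟨he, heD⟩
        exact ⟨⟨d, hd⟩, fun h => absurd h heD, x, hx⟩
    choose f hf hfx using key
    refine ⟨fun e => D.equivFin (f e), fun i => ?_⟩
    suffices ∃ u v, (G.colorSubgraph (fun e => D.equivFin (f e)) i).coe.IsDominatingEdge u v by
      obtain ⟨u, v, huv⟩ := this
      have := huv.isDoubleStar (hG.subgraph _) (exists_adj_of_mem_colorSubgraph _ i)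
      exact ⟨this.connected, this.isUnigraph⟩
    obtain ⟨⟨d, hd⟩, rfl⟩ := D.equivFin.surjective i
    have hdG := hsub hd
    have hfd : f ⟨d, hdG⟩ = ⟨d, hd⟩ := Subtype.ext (hf ⟨d, hdG⟩ hd)
    induction d using Sym2.ind with | _ u v => ?_
    refine ⟨⟨u, ⟨_, hdG⟩, congrArg _ hfd, Sym2.mem_mk_left _ _⟩,
      ⟨v, ⟨_, hdG⟩, congrArg _ hfd, Sym2.mem_mk_right _ _⟩, ⟨hdG, congrArg _ hfd⟩, ?_⟩
    rintro ⟨x, hx⟩ ⟨y, hy⟩ ⟨he, hxy⟩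
    have hxy := D.equivFin.injective hxy
    obtain ⟨z, hz, hz'⟩ := hfx ⟨_, he⟩
    rw [hxy] at hz
    simp only [Sym2.mem_iff] at hz hz'
    rcases hz' with rfl | rfl <;> rcases hz with rfl | rfl
    · exact Or.inl rfl
    · exact Or.inr (Or.inl rfl)
    · exact Or.inr (Or.inr (Or.inl rfl))
    · exact Or.inr (Or.inr (Or.inr rfl))

theorem IsAcyclic.unigraphNumber_eq {V : Type*} [Finite V] {G : SimpleGraph V}
    (hG : G.IsAcyclic) : G.unigraphNumber = G.edgeDominationNumber := by
  simp only [unigraphNumber, edgeDominationNumber, hG.isKUnigraph_iff]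

theorem exists_isEdgeDominating {V : Type*} [Finite V] (G : SimpleGraph V) :
    ∃ D : Finset (Sym2 V), G.IsEdgeDominating (D : Set (Sym2 V)) := by
  refine ⟨(Set.toFinite G.edgeSet).toFinset, ?_, ?_⟩ <;> simp

/-- The set of all edges is dominating, so the infimum is not the default value of an empty set. -/
theorem IsAcyclic.isLeast_unigraphNumber {V : Type*} [Finite V] {G : SimpleGraph V}
    (hG : G.IsAcyclic) : IsLeast {k | G.IsKUnigraph k} G.unigraphNumber := by
  obtain ⟨D, hD⟩ := G.exists_isEdgeDominating
  exact ⟨Nat.sInf_mem ⟨D.card, (hG.isKUnigraph_iff _).2 ⟨D, hD, rfl⟩⟩, fun k hk => Nat.sInf_le hk⟩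

end SimpleGraph

/-! ### Edge domination relative to vertex states, and the deletion of leaves. -/

namespace SimpleGraph

/-- `x` is an endpoint of an edge in `D`, or the state `st x` says that it is covered. -/
def IsCovered {V : Type*} (st : V → ℕ) (D : Finset (Sym2 V)) (x : V) : Prop :=
  2 ≤ st x ∨ ∃ e ∈ D, x ∈ e

/-- Edge domination relative to a state of the vertices: a vertex in state `1` has to be covered,
a vertex in state at least `2` counts as covered. Apart from edges, `D` may contain loops. -/
structure IsPartialDominating {V : Type*} (G : SimpleGraph V) (st : V → ℕ)
    (D : Finset (Sym2 V)) : Prop where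
  mem_or_isDiag : ∀ e ∈ D, e ∈ G.edgeSet ∨ e.IsDiag
  exists_mem : ∀ x, st x = 1 → ∃ e ∈ D, x ∈ e
  covered : ∀ x y, G.Adj x y → IsCovered st D x ∨ IsCovered st D y

/-- On a finite vertex set the loops at all vertices are always admissible, so this is an attained
minimum, even if a vertex that has to be covered is isolated. -/
noncomputable def partialDominationNumber {V : Type*} (G : SimpleGraph V) (st : V → ℕ) : ℕ :=
  sInf {k | ∃ D, G.IsPartialDominating st D ∧ D.card = k}

variable {V : Type*} {G : SimpleGraph V} {st : V → ℕ} {v p : V}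

theorem IsPartialDominating.partialDominationNumber_le {D : Finset (Sym2 V)}
    (h : G.IsPartialDominating st D) : G.partialDominationNumber st ≤ D.card :=
  Nat.sInf_le ⟨D, h, rfl⟩

theorem IsPartialDominating.mem_or_isDiag_of_deleteEdges {D : Finset (Sym2 V)} {s : Set (Sym2 V)}
    (h : (G.deleteEdges s).IsPartialDominating st D) :
    ∀ e ∈ D, e ∈ G.edgeSet ∨ e.IsDiag := fun e he =>
  (h.mem_or_isDiag e he).imp_left fun h => edgeSet_mono (G.deleteEdges_le s) h

section Fintype

variable [Fintype V] [DecidableEq V]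

theorem isPartialDominating_univ_diag (G : SimpleGraph V) (st : V → ℕ) :
    G.IsPartialDominating st (Finset.univ.image fun x => s(x, x)) := by
  have key : ∀ x : V, ∃ e ∈ Finset.univ.image fun x : V => s(x, x), x ∈ e := fun x =>
    ⟨s(x, x), by simp, by simp⟩
  refine ⟨fun e he => ?_, fun x _ => key x, fun x y _ => Or.inl (Or.inr (key x))⟩
  obtain ⟨x, -, rfl⟩ := Finset.mem_image.1 he
  exact Or.inr rfl

theorem exists_isPartialDominating (G : SimpleGraph V) (st : V → ℕ) :
    ∃ D, G.IsPartialDominating st D ∧ D.card = G.partialDominationNumber st :=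
  Nat.sInf_mem (s := {k | ∃ D, G.IsPartialDominating st D ∧ D.card = k})
    ⟨_, _, isPartialDominating_univ_diag G st, rfl⟩

theorem partialDominationNumber_le_card (G : SimpleGraph V) (st : V → ℕ) :
    G.partialDominationNumber st ≤ Fintype.card V :=
  (isPartialDominating_univ_diag G st).partialDominationNumber_le.trans
    (Finset.card_image_le.trans_eq Finset.card_univ)

/-- With all vertices free, loops do not help: a loop at a vertex with an incident edge can be
replaced by that edge, and a loop at an isolated vertex can be dropped. -/
theorem edgeDominationNumber_eq_partialDominationNumber (G : SimpleGraph V) (hst : ∀ x, st x = 0) :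
    G.edgeDominationNumber = G.partialDominationNumber st := by
  classical
  apply le_antisymm
  · obtain ⟨D, hD, hcard⟩ := G.exists_isPartialDominating st
    have key : ∀ e : Sym2 V, ∃ e', (∃ d ∈ G.edgeSet, ∀ x ∈ e, x ∈ d) →
        e' ∈ G.edgeSet ∧ ∀ x ∈ e, x ∈ e' := by
      intro e
      by_cases h : ∃ d ∈ G.edgeSet, ∀ x ∈ e, x ∈ d
      · exact ⟨h.choose, fun _ => h.choose_spec⟩
      · exact ⟨e, fun h' => absurd h' h⟩
    choose g hg using key
    let D' := (D.filter fun e => ∃ d ∈ G.edgeSet, ∀ x ∈ e, x ∈ d).image g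
    have hmem : ∀ e ∈ D, ∀ x y, G.Adj x y → x ∈ e → ∃ e' ∈ D', x ∈ e' := by
      intro e he x y hxy hxe
      have : ∃ d ∈ G.edgeSet, ∀ x ∈ e, x ∈ d := by
        rcases hD.mem_or_isDiag e he with h | h
        · exact ⟨e, h, fun _ => id⟩
        · obtain ⟨z, rfl⟩ := Sym2.mem_iff_exists.1 hxe
          obtain rfl : x = z := h
          exact ⟨s(x, y), hxy, by simp⟩
      exact ⟨g e, Finset.mem_image_of_mem _ (Finset.mem_filter.2 ⟨he, this⟩), (hg e this).2 x hxe⟩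
    have hD' : G.IsEdgeDominating (D' : Set (Sym2 V)) := by
      constructor
      · intro e he
        obtain ⟨d, hd, rfl⟩ := Finset.mem_image.1 (Finset.mem_coe.1 he)
        exact (hg d (Finset.mem_filter.1 hd).2).1
      · rintro e ⟨he, -⟩
        induction e using Sym2.ind with | _ x y => ?_
        rcases hD.covered x y he with (h | ⟨e, h, hx⟩) | (h | ⟨e, h, hx⟩)
        · simp [hst] at h
        · obtain ⟨e', he', hx⟩ := hmem e h x y he hx
          exact ⟨e', he', x, hx, by simp⟩
        · simp [hst] at h
        · obtain ⟨e', he', hx⟩ := hmem e h y x (Adj.symm he) hx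
          exact ⟨e', he', y, hx, by simp⟩
    have hle : G.edgeDominationNumber ≤ D'.card := Nat.sInf_le ⟨D', hD', rfl⟩
    exact hle.trans (Finset.card_image_le.trans ((Finset.card_filter_le _ _).trans hcard.le))
  · obtain ⟨D₀, hD₀⟩ := G.exists_isEdgeDominating
    obtain ⟨D, hD, hcard⟩ := Nat.sInf_mem (s := {k | ∃ D : Finset (Sym2 V),
      G.IsEdgeDominating (D : Set (Sym2 V)) ∧ D.card = k}) ⟨_, D₀, hD₀, rfl⟩
    refine le_of_le_of_eq (IsPartialDominating.partialDominationNumber_le (D := D) ?_) hcard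
    refine ⟨fun e he => Or.inl (hD.1 he), fun x hx => by simp [hst] at hx, fun x y hxy => ?_⟩
    by_cases h : s(x, y) ∈ D
    · exact Or.inl (Or.inr ⟨_, h, by simp⟩)
    · obtain ⟨e, he, z, hz, hz'⟩ := hD.2 s(x, y) ⟨hxy, h⟩
      rcases Sym2.mem_iff.1 hz' with rfl | rfl
      · exact Or.inl (Or.inr ⟨e, he, hz⟩)
      · exact Or.inr (Or.inr ⟨e, he, hz⟩)

/-- The number of vertices in state `1`. -/
def needCount (st : V → ℕ) : ℕ := (Finset.univ.filter fun x => st x = 1).card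

theorem needCount_update (st : V → ℕ) (p : V) (k : ℕ) :
    needCount (Function.update st p k) + (if st p = 1 then 1 else 0) =
      needCount st + if k = 1 then 1 else 0 := by
  have h : ∀ f : V → ℕ, needCount f =
      (if f p = 1 then 1 else 0) + ((Finset.univ.erase p).filter fun x => f x = 1).card := by
    intro f
    rw [needCount, ← Finset.insert_erase (Finset.mem_univ p), Finset.filter_insert]
    split_ifs
    · rw [Finset.card_insert_of_notMem (by simp), add_comm]
      simp
    · simp
  have h' : ((Finset.univ.erase p).filter fun x => Function.update st p k x = 1) =
      (Finset.univ.erase p).filter fun x => st x = 1 :=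
    Finset.filter_congr fun x hx => by rw [Function.update_of_ne (Finset.ne_of_mem_erase hx)]
  rw [h, h st, h', Function.update_self]
  omega

/-- Without edges only loops are available, and each covers a single vertex. -/
theorem partialDominationNumber_eq_needCount (hG : ∀ x y, ¬ G.Adj x y) :
    G.partialDominationNumber st = needCount st := by
  have hinj : Function.Injective fun x : V => s(x, x) := fun x y h => by simpa using h
  apply le_antisymm
  · rw [needCount, ← Finset.card_image_of_injective _ hinj]
    refine IsPartialDominating.partialDominationNumber_le ⟨fun e he => ?_, fun x hx => ?_,
      fun x y hxy => absurd hxy (hG x y)⟩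
    · obtain ⟨x, -, rfl⟩ := Finset.mem_image.1 he
      exact Or.inr rfl
    · exact ⟨s(x, x), Finset.mem_image_of_mem _ (by simp [hx]), by simp⟩
  · obtain ⟨D, hD, hcard⟩ := G.exists_isPartialDominating st
    rw [← hcard, needCount, ← Finset.card_image_of_injective _ hinj]
    refine Finset.card_le_card fun e he => ?_
    obtain ⟨x, hx, rfl⟩ := Finset.mem_image.1 he
    obtain ⟨e, he, hxe⟩ := hD.exists_mem x (Finset.mem_filter.1 hx).2
    obtain ⟨z, rfl⟩ := Sym2.mem_iff_exists.1 hxe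
    rcases hD.mem_or_isDiag _ he with h | h
    · exact absurd h (hG x z)
    · obtain rfl : x = z := h
      exact he

end Fintype

section Leaf

variable [DecidableEq V]

/-- A partial dominating set need not touch a leaf `v` which does not have to be covered: move it
to the neighbor `p` of `v`. -/
theorem IsPartialDominating.contract {D : Finset (Sym2 V)} (hD : G.IsPartialDominating st D)
    (hleaf : ∀ y, G.Adj v y ↔ y = p) (hv : st v ≠ 1) {st' : V → ℕ}
    (hst : ∀ x, x ≠ p → st' x = st x) (hle : st p ≤ st' p)
    (hp : st' p ≠ st p → st v = 0 ∧ st p = 0 ∧ st' p = 1) :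
    ∃ D', (G.deleteEdges {s(v, p)}).IsPartialDominating st' D' ∧ D'.card ≤ D.card := by
  have hvp : G.Adj v p := (hleaf p).2 rfl
  -- An element of `D` at the leaf is its loop or its edge to `p`; the loop at `p` does all that is
  -- still needed of either.
  let f : Sym2 V → Sym2 V := fun e => if v ∈ e then s(p, p) else e
  have edge_v : ∀ e ∈ D, v ∈ e → e = s(v, v) ∨ e = s(v, p) := by
    intro e he hve
    obtain ⟨y, rfl⟩ := Sym2.mem_iff_exists.1 hve
    rcases hD.mem_or_isDiag _ he with h | h
    · rw [(hleaf y).1 h]; exact Or.inr rfl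
    · obtain rfl : v = y := h
      exact Or.inl rfl
  have cov : ∀ x, x ≠ v → (∃ e ∈ D, x ∈ e) → ∃ e ∈ D.image f, x ∈ e := by
    rintro x hx ⟨e, he, hxe⟩
    refine ⟨f e, Finset.mem_image_of_mem _ he, ?_⟩
    by_cases hve : v ∈ e
    · simp only [f, if_pos hve]
      rcases edge_v e he hve with rfl | rfl <;> simp_all
    · simpa only [f, if_neg hve] using hxe
  have covp : (∃ e ∈ D, v ∈ e) → ∃ e ∈ D.image f, p ∈ e := by
    rintro ⟨e, he, hve⟩
    exact ⟨f e, Finset.mem_image_of_mem _ he, by simp [f, hve]⟩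
  refine ⟨D.image f, ⟨?_, ?_, ?_⟩, Finset.card_image_le⟩
  · intro d hd
    obtain ⟨e, he, rfl⟩ := Finset.mem_image.1 hd
    by_cases hve : v ∈ e
    · simp [f, hve]
    · simp only [f, if_neg hve, edgeSet_deleteEdges, Set.mem_sdiff, Set.mem_singleton_iff]
      refine (hD.mem_or_isDiag e he).imp_left fun h => ⟨h, ?_⟩
      rintro rfl
      simp at hve
  · intro x hx
    by_cases hxp : x = p
    · subst hxp
      by_cases h : st' x = st x
      · exact cov x hvp.ne.symm (hD.exists_mem x (h ▸ hx))
      -- When `p` newly has to be covered, both ends of the edge were free, so `D` touches one of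
      -- them; after the contraction it touches `p`.
      · obtain ⟨h1, h2, -⟩ := hp h
        rcases hD.covered v x hvp with (h | h) | (h | h)
        · omega
        · exact covp h
        · omega
        · exact cov x hvp.ne.symm h
    · rw [hst x hxp] at hx
      exact cov x (by rintro rfl; exact hv hx) (hD.exists_mem x hx)
  · intro x y hxy
    rw [deleteEdges_adj, Set.mem_singleton_iff] at hxy
    have hx : x ≠ v := by
      rintro rfl
      exact hxy.2 (by rw [(hleaf y).1 hxy.1])
    have hy : y ≠ v := by
      rintro rfl
      exact hxy.2 (by rw [(hleaf x).1 hxy.1.symm, Sym2.eq_swap])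
    have hc : ∀ x, x ≠ v → IsCovered st D x → IsCovered st' (D.image f) x := by
      rintro x hx (h | h)
      · left
        by_cases hxp : x = p
        · subst hxp; omega
        · rwa [hst x hxp]
      · exact Or.inr (cov x hx h)
    exact (hD.covered x y hxy.1).imp (hc x hx) (hc y hy)

variable [Fintype V]

/-- The edge at `v` is already dominated, and anything chosen at `v` can be contracted into `p`. -/
theorem partialDominationNumber_of_leaf_covered (hleaf : ∀ y, G.Adj v y ↔ y = p)
    (hv : 2 ≤ st v) :
    G.partialDominationNumber st = (G.deleteEdges {s(v, p)}).partialDominationNumber st := by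
  apply le_antisymm
  · obtain ⟨D, hD, hcard⟩ := (G.deleteEdges {s(v, p)}).exists_isPartialDominating st
    rw [← hcard]
    refine IsPartialDominating.partialDominationNumber_le
      ⟨hD.mem_or_isDiag_of_deleteEdges, hD.exists_mem, fun x y hxy => ?_⟩
    by_cases h : s(x, y) = s(v, p)
    · rcases Sym2.eq_iff.1 h with ⟨rfl, rfl⟩ | ⟨rfl, rfl⟩
      · exact Or.inl (Or.inl hv)
      · exact Or.inr (Or.inl hv)
    · exact hD.covered x y (by simp [deleteEdges_adj, hxy, h])
  · obtain ⟨D, hD, hcard⟩ := G.exists_isPartialDominating st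
    obtain ⟨D', hD', hle⟩ := hD.contract hleaf (by omega) (fun _ _ => rfl) le_rfl (by simp)
    exact hD'.partialDominationNumber_le.trans (hle.trans hcard.le)

/-- Some end of the edge must be covered, and by contraction this may be `p`. Only a free `p`
changes state: in the other states it is or will be covered anyway. -/
theorem partialDominationNumber_of_leaf_free (hleaf : ∀ y, G.Adj v y ↔ y = p) (hv : st v = 0) :
    G.partialDominationNumber st = (G.deleteEdges {s(v, p)}).partialDominationNumber
      (if st p = 0 then Function.update st p 1 else st) := by
  set st' := if st p = 0 then Function.update st p 1 else st with hst'
  have h1 : ∀ x, x ≠ p → st' x = st x := by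
    intro x hx
    simp only [hst']
    split_ifs <;> simp [hx]
  have h2 : st p = 0 → st' p = 1 := fun h => by simp [hst', h]
  have h3 : st p ≠ 0 → st' p = st p := fun h => by simp [hst', h]
  have h4 : 2 ≤ st' p → 2 ≤ st p := by
    by_cases h : st p = 0
    · rw [h2 h]; omega
    · rw [h3 h]; exact id
  apply le_antisymm
  · obtain ⟨D, hD, hcard⟩ := (G.deleteEdges {s(v, p)}).exists_isPartialDominating st'
    have hc : ∀ x, IsCovered st' D x → IsCovered st D x := by
      rintro x (h | h)
      · left
        by_cases hx : x = p
        · subst hx; exact h4 h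
        · rwa [h1 x hx] at h
      · exact Or.inr h
    have hp : IsCovered st D p := by
      by_cases h : st p = 0
      · exact Or.inr (hD.exists_mem p (h2 h))
      · by_cases h' : st p = 1
        · exact Or.inr (hD.exists_mem p (by rw [h3 h, h']))
        · left; omega
    rw [← hcard]
    refine IsPartialDominating.partialDominationNumber_le
      ⟨hD.mem_or_isDiag_of_deleteEdges, fun x hx => hD.exists_mem x ?_, fun x y hxy => ?_⟩
    · by_cases hxp : x = p
      · subst hxp; rw [h3 (by omega), hx]
      · rw [h1 x hxp, hx]
    · by_cases h : s(x, y) = s(v, p)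
      · rcases Sym2.eq_iff.1 h with ⟨rfl, rfl⟩ | ⟨rfl, rfl⟩
        · exact Or.inr hp
        · exact Or.inl hp
      · exact (hD.covered x y (by simp [deleteEdges_adj, hxy, h])).imp (hc x) (hc y)
  · obtain ⟨D, hD, hcard⟩ := G.exists_isPartialDominating st
    obtain ⟨D', hD', hle⟩ := hD.contract hleaf (by omega) h1
      (by by_cases h : st p = 0
          · omega
          · rw [h3 h])
      (fun h => by
        have h0 : st p = 0 := by by_contra h0; exact h (h3 h0)
        exact ⟨hv, h0, h2 h0⟩)
    exact hD'.partialDominationNumber_le.trans (hle.trans hcard.le)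

/-- Something at `v` must be chosen, and the edge `vp` covers at least as much as the loop at `v`.
Afterwards both ends count as covered; otherwise `v`, now isolated, would demand a loop. -/
theorem partialDominationNumber_of_leaf_need (hleaf : ∀ y, G.Adj v y ↔ y = p) (hv : st v = 1) :
    G.partialDominationNumber st = (G.deleteEdges {s(v, p)}).partialDominationNumber
      (Function.update (Function.update st v 2) p 2) + 1 := by
  have hvp : G.Adj v p := (hleaf p).2 rfl
  set st' := Function.update (Function.update st v 2) p 2 with hst'
  have h1 : ∀ x, x ≠ v → x ≠ p → st' x = st x := fun x h h' => by simp [hst', h, h']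
  have h2 : st' p = 2 := by simp [hst']
  have h3 : st' v = 2 := by simp [hst', hvp.ne]
  apply le_antisymm
  · obtain ⟨D, hD, hcard⟩ := (G.deleteEdges {s(v, p)}).exists_isPartialDominating st'
    rw [← hcard]
    refine (IsPartialDominating.partialDominationNumber_le (D := insert s(v, p) D)
      ⟨?_, fun x hx => ?_, fun x y hxy => ?_⟩).trans (Finset.card_insert_le _ _)
    · intro e he
      rcases Finset.mem_insert.1 he with rfl | he
      · exact Or.inl hvp
      · exact hD.mem_or_isDiag_of_deleteEdges e he
    · by_cases hx' : x = v ∨ x = p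
      · exact ⟨_, Finset.mem_insert_self _ _, by simpa using hx'⟩
      · push Not at hx'
        obtain ⟨e, he, hxe⟩ := hD.exists_mem x (by rw [h1 x hx'.1 hx'.2, hx])
        exact ⟨e, Finset.mem_insert_of_mem he, hxe⟩
    · have hc : ∀ x, IsCovered st' D x → IsCovered st (insert s(v, p) D) x := by
        rintro x (h | ⟨e, he, h⟩)
        · by_cases hx' : x = v ∨ x = p
          · exact Or.inr ⟨_, Finset.mem_insert_self _ _, by simpa using hx'⟩
          · push Not at hx'
            left; rwa [h1 x hx'.1 hx'.2] at h
        · exact Or.inr ⟨e, Finset.mem_insert_of_mem he, h⟩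
      by_cases h : s(x, y) = s(v, p)
      · exact Or.inl (Or.inr ⟨s(x, y), by rw [h]; exact Finset.mem_insert_self _ _, by simp⟩)
      · exact (hD.covered x y (by simp [deleteEdges_adj, hxy, h])).imp (hc x) (hc y)
  · obtain ⟨D, hD, hcard⟩ := G.exists_isPartialDominating st
    obtain ⟨e₀, he₀, hve₀⟩ := hD.exists_mem v hv
    -- Dropping all elements at `v` saves at least one and uncovers at most `v` and `p`, which the
    -- new states declare covered.
    have hlt : (D.filter fun e => v ∉ e).card < D.card :=
      Finset.card_lt_card (Finset.filter_ssubset.2 ⟨e₀, he₀, by simpa using hve₀⟩)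
    rw [← hcard]
    refine Nat.succ_le_of_lt (lt_of_le_of_lt (IsPartialDominating.partialDominationNumber_le ?_) hlt)
    have hmem : ∀ x, x ≠ v → x ≠ p → (∃ e ∈ D, x ∈ e) → ∃ e ∈ D.filter fun e => v ∉ e, x ∈ e := by
      rintro x hxv hxp ⟨e, he, hxe⟩
      refine ⟨e, Finset.mem_filter.2 ⟨he, fun hve => ?_⟩, hxe⟩
      obtain ⟨y, rfl⟩ := Sym2.mem_iff_exists.1 hve
      rcases hD.mem_or_isDiag _ he with h | h
      · rw [(hleaf y).1 h] at hxe; simp_all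
      · obtain rfl : v = y := h
        simp_all
    refine ⟨fun e he => ?_, fun x hx => ?_, fun x y hxy => ?_⟩
    · obtain ⟨he, hve⟩ := Finset.mem_filter.1 he
      refine (hD.mem_or_isDiag e he).imp_left fun h => ?_
      rw [edgeSet_deleteEdges]
      refine ⟨h, ?_⟩
      rintro rfl
      simp at hve
    · have hxv : x ≠ v := by rintro rfl; omega
      have hxp : x ≠ p := by rintro rfl; omega
      exact hmem x hxv hxp (hD.exists_mem x (by rw [← h1 x hxv hxp, hx]))
    · have hc : ∀ x, IsCovered st D x → IsCovered st' (D.filter fun e => v ∉ e) x := by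
        intro x hx
        by_cases hxv : x = v
        · subst hxv; exact Or.inl h3.ge
        · by_cases hxp : x = p
          · subst hxp; exact Or.inl h2.ge
          · exact hx.imp (fun h => by rwa [h1 x hxv hxp]) (hmem x hxv hxp)
      exact (hD.covered x y (G.deleteEdges_le _ hxy)).imp (hc x) (hc y)

end Leaf

end SimpleGraph

/-! ### Leaves of forests, and the table of degrees and neighbor sums. -/

namespace SimpleGraph

theorem IsAcyclic.exists_leaf {V : Type*} [Finite V] {G : SimpleGraph V} (hG : G.IsAcyclic)
    {a b : V} (hab : G.Adj a b) : ∃ v p, ∀ y, G.Adj v y ↔ y = p := by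
  classical
  let := Fintype.ofFinite V
  let c := G.connectedComponentMk a
  have hb : b ∈ c := (ConnectedComponent.sound hab.reachable).symm
  have : Nontrivial c := ⟨⟨a, rfl⟩, ⟨b, hb⟩, fun h => hab.ne (congrArg Subtype.val h)⟩
  obtain ⟨v, hv⟩ := (hG.isTree_connectedComponent c).exists_vert_degree_one_of_nontrivial
  obtain ⟨p, hp, hu⟩ := degree_eq_one_iff_existsUnique_adj.1 hv
  refine ⟨v, p, fun y => ⟨fun h => ?_, fun h => h ▸ hp⟩⟩
  have hy : y ∈ c := (ConnectedComponent.sound h.symm.reachable).trans v.2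
  exact congrArg Subtype.val (hu ⟨y, hy⟩ h)

/-- The arrays `d` and `S` hold the degrees of the vertices and the sums of their neighbors. -/
def IsDegreeTable {n : ℕ} (G : SimpleGraph (Fin n)) (d S : ℕ → ℕ) : Prop :=
  ∀ x : Fin n, ∃ N : Finset (Fin n), (∀ y, y ∈ N ↔ G.Adj x y) ∧ d x = N.card ∧
    S x = ∑ y ∈ N, (y : ℕ)

namespace IsDegreeTable

variable {n : ℕ} {G : SimpleGraph (Fin n)} {d S : ℕ → ℕ}

theorem degree_le (h : G.IsDegreeTable d S) {i : ℕ} (hi : i < n) : d i ≤ n := by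
  obtain ⟨N, -, h, -⟩ := h ⟨i, hi⟩
  simpa [h] using N.card_le_univ

theorem sum_le (h : G.IsDegreeTable d S) {i : ℕ} (hi : i < n) : S i ≤ n * n := by
  obtain ⟨N, -, -, h⟩ := h ⟨i, hi⟩
  rw [show S i = _ from h]
  refine (Finset.sum_le_card_nsmul N _ n fun y _ => y.2.le).trans ?_
  simpa using Nat.mul_le_mul_right n N.card_le_univ

theorem not_adj_bot (h : ∀ x y, ¬ G.Adj x y) (hd : ∀ i, d i = 0) (hS : ∀ i, S i = 0) :
    G.IsDegreeTable d S :=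
  fun x => ⟨∅, by simp [h], by simp [hd], by simp [hS]⟩

/-- The sum over a one-element neighborhood is the neighbor itself, so the table reveals it in one
look-up. -/
theorem exists_leaf (h : G.IsDegreeTable d S) {i : ℕ} (hi : i < n) (hd : d i = 1) :
    ∃ p : Fin n, S i = p ∧ ∀ y, G.Adj ⟨i, hi⟩ y ↔ y = p := by
  obtain ⟨N, hN, h1, h2⟩ := h ⟨i, hi⟩
  obtain ⟨p, rfl⟩ := Finset.card_eq_one.1 (h1.symm.trans hd)
  exact ⟨p, by simpa using h2, fun y => by rw [← hN, Finset.mem_singleton]⟩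

theorem degree_eq_one (h : G.IsDegreeTable d S) {v p : Fin n} (hleaf : ∀ y, G.Adj v y ↔ y = p) :
    d v = 1 := by
  obtain ⟨N, hN, h1, -⟩ := h v
  rw [h1, Finset.card_eq_one]
  exact ⟨p, by ext y; rw [hN, hleaf, Finset.mem_singleton]⟩

theorem insert_edge (h : G.IsDegreeTable d S) {H : SimpleGraph (Fin n)} {u w : Fin n}
    (huw : u ≠ w) (hG : ¬ G.Adj u w) (hH : ∀ x y, H.Adj x y ↔ G.Adj x y ∨ s(x, y) = s(u, w)) :
    H.IsDegreeTable (Function.update (Function.update d u (d u + 1)) w (d w + 1))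
      (Function.update (Function.update S u (S u + w)) w (S w + u)) := by
  intro x
  obtain ⟨N, hN, h1, h2⟩ := h x
  have huw' : (u : ℕ) ≠ w := Fin.val_ne_of_ne huw
  by_cases hxw : x = w
  · subst hxw
    have hu : u ∉ N := fun hu => hG ((hN u).1 hu).symm
    refine ⟨insert u N, fun y => ?_, ?_, ?_⟩
    · rw [Finset.mem_insert, hN, hH, Sym2.eq_iff]; grind
    · rw [Function.update_self, Finset.card_insert_of_notMem hu, h1]
    · rw [Function.update_self, Finset.sum_insert hu, h2, add_comm]
  · have hxw' : (x : ℕ) ≠ w := Fin.val_ne_of_ne hxw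
    by_cases hxu : x = u
    · subst hxu
      have hw : w ∉ N := fun hw => hG ((hN w).1 hw)
      refine ⟨insert w N, fun y => ?_, ?_, ?_⟩
      · rw [Finset.mem_insert, hN, hH, Sym2.eq_iff]; grind
      · rw [Function.update_of_ne hxw', Function.update_self, Finset.card_insert_of_notMem hw, h1]
      · rw [Function.update_of_ne hxw', Function.update_self, Finset.sum_insert hw, h2, add_comm]
    · have hxu' : (x : ℕ) ≠ u := Fin.val_ne_of_ne hxu
      refine ⟨N, fun y => ?_, ?_, ?_⟩
      · rw [hN, hH, Sym2.eq_iff]; grind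
      · rw [Function.update_of_ne hxw', Function.update_of_ne hxu', h1]
      · rw [Function.update_of_ne hxw', Function.update_of_ne hxu', h2]

theorem delete_leaf (h : G.IsDegreeTable d S) {v p : Fin n} (hleaf : ∀ y, G.Adj v y ↔ y = p) :
    (G.deleteEdges {s(v, p)}).IsDegreeTable
      (Function.update (Function.update d v 0) p (d p - 1))
      (Function.update (Function.update S v 0) p (S p - v)) := by
  intro x
  obtain ⟨N, hN, h1, h2⟩ := h x
  have hvp : G.Adj v p := (hleaf p).2 rfl
  have huw' : (v : ℕ) ≠ p := Fin.val_ne_of_ne hvp.ne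
  by_cases hxp : x = p
  · subst hxp
    have hv : v ∈ N := (hN v).2 hvp.symm
    refine ⟨N.erase v, fun y => ?_, ?_, ?_⟩
    · simp only [Finset.mem_erase, hN, deleteEdges_adj, Set.mem_singleton_iff, Sym2.eq_iff]
      have := hvp.ne
      grind
    · rw [Function.update_self, Finset.card_erase_of_mem hv, h1]
    · rw [Function.update_self, h2, ← Finset.add_sum_erase N _ hv, Nat.add_sub_cancel_left]
  · have hxp' : (x : ℕ) ≠ p := Fin.val_ne_of_ne hxp
    by_cases hxv : x = v
    · subst hxv
      refine ⟨∅, fun y => ?_, ?_, ?_⟩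
      · simp only [Finset.notMem_empty, deleteEdges_adj, hleaf, Set.mem_singleton_iff, false_iff]
        rintro ⟨rfl, h⟩
        exact h rfl
      · rw [Function.update_of_ne hxp', Function.update_self, Finset.card_empty]
      · rw [Function.update_of_ne hxp', Function.update_self, Finset.sum_empty]
    · have hxv' : (x : ℕ) ≠ v := Fin.val_ne_of_ne hxv
      refine ⟨N, fun y => ?_, ?_, ?_⟩
      · simp only [hN, deleteEdges_adj, Set.mem_singleton_iff, Sym2.eq_iff]
        grind
      · rw [Function.update_of_ne hxp', Function.update_of_ne hxv', h1]
      · rw [Function.update_of_ne hxp', Function.update_of_ne hxv', h2]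

end IsDegreeTable

end SimpleGraph

/-! ### Weakest preconditions and running times of programs. -/

namespace WordRAM

/-- The weakest precondition of a program without loops. -/
def Prog.wp (b : ℕ) : Prog → (State → Prop) → State → Prop
  | .skip, Q, s => Q s
  | .const x k, Q, s => k < 2 ^ b ∧ Q (s.setReg x k)
  | .add x y z, Q, s => s.reg y + s.reg z < 2 ^ b ∧ Q (s.setReg x (s.reg y + s.reg z))
  | .sub x y z, Q, s => s.reg y - s.reg z < 2 ^ b ∧ Q (s.setReg x (s.reg y - s.reg z))
  | .load x a y, Q, s => s.mem a (s.reg y) < 2 ^ b ∧ Q (s.setReg x (s.mem a (s.reg y)))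
  | .store a y z, Q, s => s.reg z < 2 ^ b ∧ Q (s.setMem a (s.reg y) (s.reg z))
  | .seq p q, Q, s => p.wp b (q.wp b Q) s
  | .ifLt x y p q, Q, s =>
      (s.reg x < s.reg y → p.wp b Q s) ∧ (¬ s.reg x < s.reg y → q.wp b Q s)
  | .whileLt _ _ _, _, _ => False

/-- A bound for the running time of a program without loops. -/
def Prog.time : Prog → ℕ
  | .seq p q => p.time + q.time
  | .ifLt _ _ p q => max p.time q.time + 1
  -- For loops this value is meaningless but harmless, since their weakest precondition is `False`.
  | _ => 1

theorem Prog.exists_exec_of_wp {b : ℕ} (P : Prog) {Q : State → Prop} {s : State}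
    (h : P.wp b Q s) : ∃ t ≤ P.time, ∃ s', Exec b P s t s' ∧ Q s' := by
  induction P generalizing Q s with
  | skip => exact ⟨1, le_rfl, _, .skip s, h⟩
  | const x k => exact ⟨1, le_rfl, _, .const s x k h.1, h.2⟩
  | add x y z => exact ⟨1, le_rfl, _, .add s x y z h.1, h.2⟩
  | sub x y z => exact ⟨1, le_rfl, _, .sub s x y z h.1, h.2⟩
  | load x a y => exact ⟨1, le_rfl, _, .load s x a y h.1, h.2⟩
  | store a y z => exact ⟨1, le_rfl, _, .store s a y z h.1, h.2⟩
  | seq p q ihp ihq =>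
    obtain ⟨t, ht, s', hp, h'⟩ := ihp h
    obtain ⟨t', ht', s'', hq, h''⟩ := ihq h'
    exact ⟨t + t', Nat.add_le_add ht ht', s'', .seq hp hq, h''⟩
  | ifLt x y p q ihp ihq =>
    by_cases hlt : s.reg x < s.reg y
    · obtain ⟨t, ht, s', hp, h'⟩ := ihp (h.1 hlt)
      exact ⟨t + 1, Nat.succ_le_succ (ht.trans (le_max_left _ _)), s', .ifTrue hlt hp, h'⟩
    · obtain ⟨t, ht, s', hp, h'⟩ := ihq (h.2 hlt)
      exact ⟨t + 1, Nat.succ_le_succ (ht.trans (le_max_right _ _)), s', .ifFalse hlt hp, h'⟩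
  | whileLt x y p => exact h.elim

theorem Prog.wp_mono {b : ℕ} (P : Prog) {Q Q' : State → Prop} (h : ∀ s, Q s → Q' s) {s : State}
    (hs : P.wp b Q s) : P.wp b Q' s := by
  induction P generalizing Q Q' s with
  | skip => exact h _ hs
  | seq p q ihp ihq => exact ihp (fun s hs => ihq h hs) hs
  | ifLt x y p q ihp ihq => exact ⟨fun hlt => ihp h (hs.1 hlt), fun hlt => ihq h (hs.2 hlt)⟩
  | whileLt => exact hs
  | _ => exact ⟨hs.1, h _ hs.2⟩

/-- The loop rule, with an invariant `I k` that holds when at most `k` rounds are left. -/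
theorem exists_exec_whileLt {b x y : ℕ} {P : Prog} {I : ℕ → State → Prop}
    (step : ∀ k s, I k s → s.reg x < s.reg y → P.wp b (fun s' => ∃ k' < k, I k' s') s)
    (k : ℕ) {s : State} (h : I k s) :
    ∃ t ≤ k * (P.time + 1) + 1, ∃ s', Exec b (.whileLt x y P) s t s' ∧
      ¬ s'.reg x < s'.reg y ∧ ∃ k', I k' s' := by
  induction k using Nat.strong_induction_on generalizing s with
  | _ k ih =>
    by_cases hlt : s.reg x < s.reg y
    · obtain ⟨t, ht, s₁, hp, k', hk', hI⟩ := P.exists_exec_of_wp (step k s h hlt)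
      obtain ⟨t', ht', s₂, hw, h₂⟩ := ih k' hk' hI
      refine ⟨t + t' + 1, ?_, s₂, .whileTrue hlt hp hw, h₂⟩
      have := Nat.mul_le_mul_right (P.time + 1) (Nat.succ_le_of_lt hk')
      rw [Nat.succ_mul] at this
      omega
    · exact ⟨1, by omega, s, .whileFalse hlt, hlt, k, h⟩

theorem State.reg_setReg (s : State) (x v y : ℕ) :
    (s.setReg x v).reg y = if y = x then v else s.reg y := by
  simp [State.setReg, Function.update_apply]

theorem State.mem_setReg (s : State) (x v : ℕ) : (s.setReg x v).mem = s.mem := rfl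

theorem State.reg_setMem (s : State) (a i v : ℕ) : (s.setMem a i v).reg = s.reg := rfl

theorem State.mem_setMem (s : State) (a i v c : ℕ) :
    (s.setMem a i v).mem c = if c = a then Function.update (s.mem a) i v else s.mem c := by
  simp only [State.setMem, Function.update_apply]

end WordRAM

/-! ### The program and its loop-free pieces. -/

namespace WordRAM

open SimpleGraph

/-- Enter the edge with number `reg 2` into the arrays `2` (degrees) and `3` (sums of neighbors). -/
def enterEdge : Prog :=
  .seq (.load 4 0 2) <| .seq (.load 5 1 2) <|
  .seq (.load 6 2 4) <| .seq (.add 6 6 1) <|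
  .seq (.load 10 2 5) <| .seq (.add 10 10 1) <|
  .seq (.load 11 3 4) <| .seq (.add 11 11 5) <|
  .seq (.load 12 3 5) <| .seq (.add 12 12 4) <|
  .seq (.store 2 4 6) <| .seq (.store 2 5 10) <|
  .seq (.store 3 4 11) <| .seq (.store 3 5 12) <| .add 2 2 1

/-- Delete the leaf `reg 8`, move on to its neighbor and read the states of both. -/
def detachLeaf : Prog :=
  .seq (.load 10 3 8) <| .seq (.load 5 2 10) <| .seq (.sub 5 5 1) <|
  .seq (.load 6 3 10) <| .seq (.sub 6 6 8) <|
  .seq (.store 2 8 9) <| .seq (.store 2 10 5) <|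
  .seq (.store 3 8 9) <| .seq (.store 3 10 6) <|
  .seq (.load 11 4 8) <| .seq (.load 12 4 10) <|
  .seq (.add 14 8 9) <| .add 8 10 9

/-- Update the states (array `4`) of the deleted leaf `reg 14` and of its neighbor `reg 10`. The
register `7` holds the number of edges chosen so far plus the number of vertices in state `1`. -/
def updateStates : Prog :=
  .ifLt 11 1
    (.ifLt 12 1 (.seq (.store 4 10 1) (.add 7 7 1)) .skip)
    (.ifLt 1 11 .skip <|
      .seq (.const 13 2) <| .seq (.store 4 14 13) <| .seq (.store 4 10 13) <|
      .ifLt 12 1 .skip (.ifLt 1 12 .skip (.sub 7 7 1)))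

/-- If `reg 8` is a leaf, then delete it, else proceed to the next vertex. -/
def stripStep : Prog :=
  -- With truncated subtraction, `(1 - d) + (d - 1)` vanishes exactly for `d = 1`.
  .seq (.load 4 2 8) <| .seq (.sub 5 1 4) <| .seq (.sub 6 4 1) <| .seq (.add 5 5 6) <|
  .ifLt 5 1 (.seq detachLeaf updateStates) (.seq (.add 2 2 1) (.add 8 2 9))

/-- Compute the edge domination number of a tree by repeated deletion of leaves. -/
def treeEdgeDomination : Prog :=
  -- Registers `1` and `9` serve as the constants one and zero, and adding register `9` copies a
  -- register. A tree has `n - 1` edges, which bounds the first loop.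
  .seq (.seq (.const 1 1) (.sub 3 0 1)) <| .seq (.whileLt 2 3 enterEdge) <|
  .seq (.seq (.const 2 0) (.const 8 0)) <| .seq (.whileLt 2 0 stripStep) (.add 0 7 9)

theorem wp_enterEdge {b : ℕ} {s : State} {u w : ℕ} (hu : s.mem 0 (s.reg 2) = u)
    (hw : s.mem 1 (s.reg 2) = w) (h1 : s.reg 1 = 1) (hub : u < 2 ^ b) (hwb : w < 2 ^ b)
    (hdu : s.mem 2 u + 1 < 2 ^ b) (hdw : s.mem 2 w + 1 < 2 ^ b)
    (hSu : s.mem 3 u + w < 2 ^ b) (hSw : s.mem 3 w + u < 2 ^ b) (h2 : s.reg 2 + 1 < 2 ^ b) :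
    enterEdge.wp b (fun s' => (s'.reg 0 = s.reg 0 ∧ s'.reg 1 = 1 ∧ s'.reg 2 = s.reg 2 + 1 ∧
      s'.reg 3 = s.reg 3 ∧ s'.reg 7 = s.reg 7 ∧ s'.reg 9 = s.reg 9) ∧
      s'.mem 0 = s.mem 0 ∧ s'.mem 1 = s.mem 1 ∧
      s'.mem 2 = Function.update (Function.update (s.mem 2) u (s.mem 2 u + 1)) w (s.mem 2 w + 1) ∧
      s'.mem 3 = Function.update (Function.update (s.mem 3) u (s.mem 3 u + w)) w (s.mem 3 w + u) ∧
      s'.mem 4 = s.mem 4) s := by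
  simp [enterEdge, Prog.wp, State.reg_setReg, State.mem_setReg, State.reg_setMem, State.mem_setMem,
    hu, hw, h1, hub, hwb, hdu, hdw, hSu, hSw, h2]
  omega

theorem wp_detachLeaf {b : ℕ} {s : State} {v p : ℕ} (hv : s.reg 8 = v) (hp : s.mem 3 v = p)
    (h1 : s.reg 1 = 1) (h9 : s.reg 9 = 0) (hvb : v < 2 ^ b) (hpb : p < 2 ^ b)
    (hdp : s.mem 2 p < 2 ^ b) (hSp : s.mem 3 p < 2 ^ b)
    (hsv : s.mem 4 v < 2 ^ b) (hsp : s.mem 4 p < 2 ^ b) :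
    detachLeaf.wp b (fun s' => (s'.reg 0 = s.reg 0 ∧ s'.reg 1 = 1 ∧ s'.reg 2 = s.reg 2 ∧
      s'.reg 7 = s.reg 7 ∧ s'.reg 9 = 0 ∧ s'.reg 8 = p ∧ s'.reg 10 = p ∧ s'.reg 14 = v ∧
      s'.reg 11 = s.mem 4 v ∧ s'.reg 12 = s.mem 4 p) ∧
      s'.mem 2 = Function.update (Function.update (s.mem 2) v 0) p (s.mem 2 p - 1) ∧
      s'.mem 3 = Function.update (Function.update (s.mem 3) v 0) p (s.mem 3 p - v) ∧
      s'.mem 4 = s.mem 4) s := by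
  have e1 := lt_of_le_of_lt (Nat.sub_le _ 1) hdp
  have e2 := lt_of_le_of_lt (Nat.sub_le _ v) hSp
  simp [detachLeaf, Prog.wp, State.reg_setReg, State.mem_setReg, State.reg_setMem,
    State.mem_setMem, hv, hp, h1, h9, hvb, hpb, hdp, hSp, hsv, hsp, e1, e2]

end WordRAM

/-! ### Bookkeeping of the optimum during the deletions. -/

namespace SimpleGraph

/-- In a run on a graph with edge domination number `o`, `G` is the graph that is left, `m` holds
the states of the vertices and `a` the number of chosen edges plus the number of vertices in
state `1`. -/
def IsLedger {n : ℕ} (o : ℕ) (G : SimpleGraph (Fin n)) (m : ℕ → ℕ) (a : ℕ) : Prop :=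
  ∃ c, o = G.partialDominationNumber (fun x : Fin n => m x) + c ∧
    a = c + needCount fun x : Fin n => m x

namespace IsLedger

variable {n o a : ℕ} {G : SimpleGraph (Fin n)} {m : ℕ → ℕ} {v p : Fin n}

theorem le (h : IsLedger o G m a) : a ≤ o + n := by
  obtain ⟨c, h1, h2⟩ := h
  have : needCount (fun x : Fin n => m x) ≤ n :=
    (Finset.card_filter_le _ _).trans (by simp)
  omega

/-- Once no edge is left, the remaining optimum is the number of vertices in state `1`, which `a`
has counted in advance; no final pass over the states is needed. -/
theorem eq_of_not_adj (h : IsLedger o G m a) (hG : ∀ x y, ¬ G.Adj x y) : a = o := by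
  obtain ⟨c, h1, h2⟩ := h
  rw [partialDominationNumber_eq_needCount hG] at h1
  omega

theorem update_val (m : ℕ → ℕ) (p : Fin n) (k : ℕ) :
    (fun x : Fin n => Function.update m p k x) = Function.update (fun x : Fin n => m x) p k :=
  Function.update_comp_eq_of_injective m Fin.val_injective p k

theorem leaf_covered (h : IsLedger o G m a) (hleaf : ∀ y, G.Adj v y ↔ y = p) (hv : 2 ≤ m v) :
    IsLedger o (G.deleteEdges {s(v, p)}) m a := by
  obtain ⟨c, h1, h2⟩ := h
  exact ⟨c, by rw [h1, partialDominationNumber_of_leaf_covered hleaf hv], h2⟩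

theorem leaf_free (h : IsLedger o G m a) (hleaf : ∀ y, G.Adj v y ↔ y = p) (hv : m v = 0)
    (hp : m p ≠ 0) : IsLedger o (G.deleteEdges {s(v, p)}) m a := by
  obtain ⟨c, h1, h2⟩ := h
  exact ⟨c, by rw [h1, partialDominationNumber_of_leaf_free hleaf hv, if_neg hp], h2⟩

theorem leaf_free_free (h : IsLedger o G m a) (hleaf : ∀ y, G.Adj v y ↔ y = p) (hv : m v = 0)
    (hp : m p = 0) : IsLedger o (G.deleteEdges {s(v, p)}) (Function.update m p 1) (a + 1) := by
  obtain ⟨c, h1, h2⟩ := h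
  have := needCount_update (fun x : Fin n => m x) p 1
  simp only [hp] at this
  refine ⟨c, ?_, ?_⟩
  · rw [h1, partialDominationNumber_of_leaf_free hleaf hv, if_pos hp, update_val]
  · rw [update_val]
    simp at this
    omega

/-- The newly chosen edge replaces `v` in the count, so the total changes only if `p` also stops
being in state `1`. -/
theorem leaf_need (h : IsLedger o G m a) (hleaf : ∀ y, G.Adj v y ↔ y = p) (hv : m v = 1) :
    IsLedger o (G.deleteEdges {s(v, p)}) (Function.update (Function.update m v 2) p 2)
      (a - if m p = 1 then 1 else 0) := by
  obtain ⟨c, h1, h2⟩ := h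
  have hvp : p ≠ v := ((hleaf p).2 rfl).ne.symm
  have e1 := needCount_update (fun x : Fin n => m x) v 2
  have e2 := needCount_update (Function.update (fun x : Fin n => m x) v 2) p 2
  simp only [hv, Function.update_of_ne hvp] at e1 e2
  refine ⟨c + 1, ?_, ?_⟩
  · rw [h1, partialDominationNumber_of_leaf_need hleaf hv, update_val, update_val]
    omega
  · rw [update_val, update_val]
    simp at e1 e2
    omega

end IsLedger

end SimpleGraph

/-! ### Correctness of one round of leaf deletion. -/

namespace WordRAM

open SimpleGraph

theorem wp_updateStates {n b o : ℕ} {G : SimpleGraph (Fin n)} {s : State} {v p : Fin n}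
    (hleaf : ∀ y, G.Adj v y ↔ y = p) (h : IsLedger o G (s.mem 4) (s.reg 7))
    (hst : ∀ i, s.mem 4 i ≤ 2) (h1 : s.reg 1 = 1) (h10 : s.reg 10 = p) (h14 : s.reg 14 = v)
    (h11 : s.reg 11 = s.mem 4 v) (h12 : s.reg 12 = s.mem 4 p) (h7 : s.reg 7 + 1 < 2 ^ b)
    (hb : 2 < 2 ^ b) :
    updateStates.wp b (fun s' => (s'.reg 0 = s.reg 0 ∧ s'.reg 1 = s.reg 1 ∧
      s'.reg 2 = s.reg 2 ∧ s'.reg 8 = s.reg 8 ∧ s'.reg 9 = s.reg 9 ∧ s'.mem 2 = s.mem 2 ∧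
      s'.mem 3 = s.mem 3) ∧ IsLedger o (G.deleteEdges {s(v, p)}) (s'.mem 4) (s'.reg 7) ∧
      ∀ i, s'.mem 4 i ≤ 2) s := by
  have hb1 : 1 < 2 ^ b := by omega
  have hb7 : s.reg 7 - 1 < 2 ^ b := by omega
  have hup : ∀ (m : ℕ → ℕ) (j k : ℕ), (∀ i, m i ≤ 2) → k ≤ 2 → ∀ i,
      Function.update m j k i ≤ 2 := by
    intro m j k hm hk i
    rw [Function.update_apply]
    split_ifs
    · exact hk
    · exact hm i
  simp only [updateStates, Prog.wp, State.reg_setReg, State.mem_setReg, State.reg_setMem,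
    State.mem_setMem, h1, h10, h14, h11, h12, h7, hb, hb1, hb7, reduceIte, Nat.reduceEqDiff,
    true_and, Nat.lt_one_iff]
  refine ⟨fun hv => ⟨fun hp => ?_, fun hp => ?_⟩, fun hv => ⟨fun hv' => ?_, fun hv' =>
    ⟨fun hp => ?_, fun hp => ⟨fun hp' => ?_, fun hp' => ?_⟩⟩⟩⟩
  · exact ⟨h.leaf_free_free hleaf hv hp, hup _ _ _ hst (by omega)⟩
  · exact ⟨h.leaf_free hleaf hv hp, hst⟩
  · exact ⟨h.leaf_covered hleaf hv', hst⟩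
  all_goals
    have hv1 : s.mem 4 v = 1 := by omega
    have key := h.leaf_need hleaf hv1
  · rw [if_neg (by omega)] at key
    exact ⟨key, hup _ _ _ (hup _ _ _ hst le_rfl) le_rfl⟩
  · rw [if_neg (by omega)] at key
    exact ⟨key, hup _ _ _ (hup _ _ _ hst le_rfl) le_rfl⟩
  · rw [if_pos (by omega)] at key
    exact ⟨key, hup _ _ _ (hup _ _ _ hst le_rfl) le_rfl⟩

/-- The invariant of the second loop: `G` is the graph that is left, and only `reg 8` can be a leaf
of it among the vertices up to `reg 2`. -/
structure IsStripping {n : ℕ} (o : ℕ) (G : SimpleGraph (Fin n)) (s : State) : Prop where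
  isAcyclic : G.IsAcyclic
  table : G.IsDegreeTable (s.mem 2) (s.mem 3)
  ledger : IsLedger o G (s.mem 4) (s.reg 7)
  states_le : ∀ i, s.mem 4 i ≤ 2
  reg_zero : s.reg 0 = n
  reg_one : s.reg 1 = 1
  reg_nine : s.reg 9 = 0
  le : s.reg 2 ≤ n
  -- When the scan ends, `reg 8` is out of range too, so `not_leaf` then has no exception among the
  -- vertices.
  lt_iff : s.reg 8 < n ↔ s.reg 2 < n
  not_leaf : ∀ i < n, i ≤ s.reg 2 → i ≠ s.reg 8 → s.mem 2 i ≠ 1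

/-- A deletion alters only the degrees of the leaf, which becomes isolated, and of its neighbor,
which becomes the new exception `reg 8`. The potential is the number of vertices left to scan plus
the number of edges left. In the word bound, `n * n` accounts for neighbor sums and `2 * n` for `reg
7`. -/
theorem IsStripping.wp_stripStep {n b o : ℕ} {G : SimpleGraph (Fin n)} {s : State}
    (h : IsStripping o G s) (hlt : s.reg 2 < s.reg 0) (ho : o ≤ n)
    (hb : n * n + 2 * n + 2 < 2 ^ b) :
    stripStep.wp b (fun s' => ∃ H : SimpleGraph (Fin n), IsStripping o H s' ∧
      (n - s'.reg 2) + H.edgeSet.ncard < (n - s.reg 2) + G.edgeSet.ncard) s := by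
  have h2 : s.reg 2 < n := by rw [← h.reg_zero]; exact hlt
  have h8 : s.reg 8 < n := h.lt_iff.2 h2
  have hd := h.table.degree_le h8
  have b1 : s.mem 2 (s.reg 8) < 2 ^ b := by omega
  have b2 : 1 - s.mem 2 (s.reg 8) < 2 ^ b := by omega
  have b3 : s.mem 2 (s.reg 8) - 1 < 2 ^ b := by omega
  have b4 : 1 - s.mem 2 (s.reg 8) + (s.mem 2 (s.reg 8) - 1) < 2 ^ b := by omega
  have b5 : s.reg 2 + 1 < 2 ^ b := by omega
  simp only [stripStep, Prog.wp, State.reg_setReg, h.reg_one, h.reg_nine, b1, b2, b3,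
    b4, b5, reduceIte, Nat.reduceEqDiff, true_and, Nat.lt_one_iff, add_zero]
  refine ⟨fun hleaf => ?_, fun hleaf => ?_⟩
  · obtain ⟨p, hp, hadj⟩ := h.table.exists_leaf h8 (by omega)
    have hne : (⟨s.reg 8, h8⟩ : Fin n) ≠ p := ((hadj p).2 rfl).ne
    have hdp := h.table.degree_le p.2
    have hSp := h.table.sum_le p.2
    have hs8 := h.states_le (s.reg 8)
    have hsp := h.states_le p
    have hp2 := p.2
    have ha := h.ledger.le
    refine Prog.wp_mono _ ?_ (wp_detachLeaf (v := s.reg 8) (p := p) (by simp [State.reg_setReg])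
      (by simpa [State.mem_setReg] using hp) (by simp [State.reg_setReg, h.reg_one])
      (by simp [State.reg_setReg, h.reg_nine]) (by omega) (by omega)
      (by simp only [State.mem_setReg]; omega) (by simp only [State.mem_setReg]; omega)
      (by simp only [State.mem_setReg]; omega) (by simp only [State.mem_setReg]; omega))
    rintro s₁ ⟨⟨r0, r1, r2, r7, r9, r8, r10, r14, r11, r12⟩, m2, m3, m4⟩
    simp only [State.reg_setReg, State.mem_setReg, Nat.reduceEqDiff, reduceIte] at *
    refine Prog.wp_mono _ ?_ (wp_updateStates (o := o) hadj (by rw [m4, r7]; exact h.ledger)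
      (by rw [m4]; exact h.states_le) r1 r10 r14 (by rw [r11, m4]) (by rw [r12, m4]) (by omega)
      (by omega))
    rintro s₂ ⟨⟨q0, q1, q2, q8, q9, n2, n3⟩, hled, hst⟩
    refine ⟨_, ⟨h.isAcyclic.anti (deleteEdges_le _), ?_, hled, hst, ?_, ?_, ?_, ?_, ?_, ?_⟩, ?_⟩
    · rw [n2, n3, m2, m3]
      exact h.table.delete_leaf hadj
    · rw [q0, r0, h.reg_zero]
    · rw [q1, r1]
    · rw [q9, r9]
    · rw [q2, r2]; exact h.le
    · rw [q8, r8, q2, r2]; simp [h2]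
    · rw [q8, r8, q2, r2, n2, m2]
      intro i hi hi2 hip
      rw [Function.update_of_ne hip, Function.update_apply]
      split_ifs with hi8
      · omega
      · exact h.not_leaf i hi hi2 hi8
    · have hmem : s(⟨s.reg 8, h8⟩, p) ∈ G.edgeSet := (hadj p).2 rfl
      rw [q2, r2, edgeSet_deleteEdges]
      have := Set.ncard_sdiff_singleton_lt_of_mem hmem
      omega
  · refine ⟨G, ⟨h.isAcyclic, h.table, h.ledger, h.states_le, ?_, ?_, ?_, ?_, ?_, ?_⟩, ?_⟩
    · simpa [State.reg_setReg] using h.reg_zero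
    · simpa [State.reg_setReg] using h.reg_one
    · simpa [State.reg_setReg] using h.reg_nine
    · simpa [State.reg_setReg] using h2
    · simp [State.reg_setReg]
    · simp only [State.reg_setReg, State.mem_setReg, Nat.reduceEqDiff, reduceIte]
      intro i hi hi2 hne
      by_cases hi8 : i = s.reg 8
      · subst hi8; omega
      · exact h.not_leaf i hi (by omega) hi8
    · omega

end WordRAM

/-! ### Graphs built up from an edge list. -/

namespace SimpleGraph

/-- The graph of the first `j` edges of the list `l`. -/
def takeEdges {V : Type*} (l : List (V × V)) (j : ℕ) : SimpleGraph V :=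
  fromEdgeSet {e | e ∈ (l.map fun p => s(p.1, p.2)).take j}

namespace IsEdgeList

variable {V : Type*} {T : SimpleGraph V} {l : List (V × V)}

theorem adj_get (h : T.IsEdgeList l) {j : ℕ} (hj : j < l.length) : T.Adj l[j].1 l[j].2 :=
  (h.2 _).1 (List.mem_map.2 ⟨l[j], List.getElem_mem hj, rfl⟩)

theorem takeEdges_succ (h : T.IsEdgeList l) {j : ℕ} (hj : j < l.length) (x y : V) :
    (takeEdges l (j + 1)).Adj x y ↔ (takeEdges l j).Adj x y ∨ s(x, y) = s(l[j].1, l[j].2) := by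
  have hj' : j < (l.map fun p => s(p.1, p.2)).length := by simpa using hj
  have hne := (h.adj_get hj).ne
  simp only [takeEdges, fromEdgeSet_adj, Set.mem_ofPred_eq, ← List.take_concat_get' _ _ hj',
    List.mem_append, List.mem_singleton, List.getElem_map, Sym2.eq_iff]
  grind

theorem not_adj_takeEdges (h : T.IsEdgeList l) {j : ℕ} (hj : j < l.length) :
    ¬ (takeEdges l j).Adj l[j].1 l[j].2 := by
  intro hadj
  have hj' : j < (l.map fun p => s(p.1, p.2)).length := by simpa using hj
  have hmem : s(l[j].1, l[j].2) ∈ (l.map fun p => s(p.1, p.2)).take j :=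
    ((fromEdgeSet_adj _).1 hadj).1
  have hnd := h.1.sublist (List.take_sublist (j + 1) _)
  rw [← List.take_concat_get' _ _ hj', List.nodup_append] at hnd
  exact hnd.2.2 _ hmem _ (List.mem_singleton_self _) (List.getElem_map _).symm

theorem takeEdges_length (h : T.IsEdgeList l) : takeEdges l l.length = T := by
  ext x y
  rw [takeEdges, fromEdgeSet_adj, List.take_of_length_le (by simp)]
  exact ⟨fun hxy => (h.2 _).1 hxy.1, fun hxy => ⟨(h.2 _).2 hxy, hxy.ne⟩⟩

theorem length_eq (h : T.IsEdgeList l) : l.length = T.edgeSet.ncard := by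
  classical
  have : T.edgeSet = ((l.map fun p => s(p.1, p.2)).toFinset : Set (Sym2 V)) := by
    ext e
    rw [List.coe_toFinset]
    exact (h.2 e).symm
  rw [this, Set.ncard_coe_finset, List.toFinset_card_of_nodup h.1, List.length_map]

end IsEdgeList

theorem IsTree.ncard_edgeSet {V : Type*} [Finite V] {T : SimpleGraph V} (hT : T.IsTree) :
    T.edgeSet.ncard + 1 = Nat.card V := by
  classical
  let := Fintype.ofFinite V
  rw [← coe_edgeFinset, Set.ncard_coe_finset, hT.card_edgeFinset, Nat.card_eq_fintype_card]

end SimpleGraph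

/-! ### Correctness and running time of the whole program. -/

namespace WordRAM

open SimpleGraph

/-- The invariant of the first loop: the first `reg 2` edges have been entered. -/
structure IsEntering {n : ℕ} (l : List (Fin n × Fin n)) (s : State) : Prop where
  mem_zero : s.mem 0 = (input n l).mem 0
  mem_one : s.mem 1 = (input n l).mem 1
  table : (takeEdges l (s.reg 2)).IsDegreeTable (s.mem 2) (s.mem 3)
  mem_four : ∀ i, s.mem 4 i = 0
  reg_zero : s.reg 0 = n
  reg_one : s.reg 1 = 1
  reg_three : s.reg 3 = l.length
  reg_seven : s.reg 7 = 0
  reg_nine : s.reg 9 = 0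
  le : s.reg 2 ≤ l.length

theorem IsEntering.wp_enterEdge {n b : ℕ} {T : SimpleGraph (Fin n)} {l : List (Fin n × Fin n)}
    {s : State} (h : IsEntering l s) (hl : T.IsEdgeList l) (hlt : s.reg 2 < s.reg 3)
    (hln : l.length ≤ n) (hb : n * n + 2 * n + 2 < 2 ^ b) :
    enterEdge.wp b (fun s' => IsEntering l s' ∧ s'.reg 2 = s.reg 2 + 1) s := by
  have hj : s.reg 2 < l.length := by rw [← h.reg_three]; exact hlt
  have hu := l[s.reg 2].1.2
  have hw := l[s.reg 2].2.2
  have := h.table.degree_le hu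
  have := h.table.degree_le hw
  have := h.table.sum_le hu
  have := h.table.sum_le hw
  refine Prog.wp_mono _ ?_ (WordRAM.wp_enterEdge (u := l[s.reg 2].1) (w := l[s.reg 2].2)
    (by simp [h.mem_zero, input, hj]) (by simp [h.mem_one, input, hj]) h.reg_one
    (by omega) (by omega) (by omega) (by omega) (by omega) (by omega) (by omega))
  rintro s' ⟨⟨r0, r1, r2, r3, r7, r9⟩, m0, m1, m2, m3, m4⟩
  refine ⟨⟨by rw [m0, h.mem_zero], by rw [m1, h.mem_one], ?_, by rw [m4]; exact h.mem_four,
    by rw [r0, h.reg_zero], r1, by rw [r3, h.reg_three], by rw [r7, h.reg_seven],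
    by rw [r9, h.reg_nine], by omega⟩, r2⟩
  rw [m2, m3, r2]
  exact h.table.insert_edge (hl.adj_get hj).ne (hl.not_adj_takeEdges hj) (hl.takeEdges_succ hj)

/-- At the end of the scan no vertex is a leaf, and a forest without leaves has no edges. -/
theorem IsStripping.reg_seven_eq {n o : ℕ} {G : SimpleGraph (Fin n)} {s : State}
    (h : IsStripping o G s) (hge : ¬ s.reg 2 < s.reg 0) : s.reg 7 = o := by
  rw [h.reg_zero] at hge
  have h8 : ¬ s.reg 8 < n := fun h' => hge (h.lt_iff.1 h')
  refine h.ledger.eq_of_not_adj fun x y hxy => ?_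
  obtain ⟨v, p, hleaf⟩ := h.isAcyclic.exists_leaf hxy
  exact h.not_leaf v v.2 (by omega) (by omega) (h.table.degree_eq_one hleaf)

theorem exists_exec_treeEdgeDomination {n b : ℕ} {T : SimpleGraph (Fin n)} (hT : T.IsTree)
    {l : List (Fin n × Fin n)} (hl : T.IsEdgeList l) (hb : n * n + 2 * n + 2 < 2 ^ b) :
    ∃ (t : ℕ) (s : State), Exec b treeEdgeDomination (input n l) t s ∧ t ≤ 100 * n ∧
      s.reg 0 = T.edgeDominationNumber := by
  have hcard : l.length + 1 = n := by
    rw [hl.length_eq, hT.ncard_edgeSet, Nat.card_eq_fintype_card, Fintype.card_fin]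
  have ho := T.edgeDominationNumber_eq_partialDominationNumber (st := fun _ => 0) fun _ => rfl
  have hon : T.edgeDominationNumber ≤ n := by
    rw [ho]
    exact (partialDominationNumber_le_card T _).trans_eq (Fintype.card_fin n)
  obtain ⟨t₁, ht₁, s₁, hx₁, hI₁⟩ := Prog.exists_exec_of_wp (b := b)
    (.seq (.const 1 1) (.sub 3 0 1)) (Q := IsEntering l) (s := input n l) (by
      simp only [Prog.wp, State.reg_setReg]
      refine ⟨by omega, by simp [input]; omega, rfl, rfl, ?_, fun i => rfl, ?_, ?_, ?_, ?_, ?_, ?_⟩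
      · refine IsDegreeTable.not_adj_bot (fun x y => ?_) (fun i => rfl) (fun i => rfl)
        simp [takeEdges, State.reg_setReg, input]
      all_goals simp [State.reg_setReg, input]
      omega)
  obtain ⟨t₂, ht₂, s₂, hx₂, hge₂, -, hI₂, -⟩ := exists_exec_whileLt (b := b) (x := 2) (y := 3)
    (P := enterEdge) (I := fun k s => IsEntering l s ∧ k = l.length - s.reg 2)
    (fun k s h hlt => Prog.wp_mono _ (fun s' h' => ⟨_, by have := h'.1.le; omega, h'.1, rfl⟩)
      (h.1.wp_enterEdge hl hlt (by omega) hb)) _ ⟨hI₁, rfl⟩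
  obtain ⟨t₃, ht₃, s₃, hx₃, hI₃, hr₃⟩ := Prog.exists_exec_of_wp (b := b)
    (.seq (.const 2 0) (.const 8 0))
    (Q := fun s => IsStripping T.edgeDominationNumber T s ∧ s.reg 2 = 0) (s := s₂) (by
      simp only [Prog.wp, State.reg_setReg]
      have hlen : s₂.reg 2 = l.length := by have := hI₂.le; have := hI₂.reg_three; omega
      have htab := hI₂.table
      rw [hlen, hl.takeEdges_length] at htab
      refine ⟨by omega, by omega, ⟨hT.isAcyclic, htab, ?_, fun i => ?_, ?_, ?_, ?_, ?_, ?_, ?_⟩, ?_⟩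
      · refine ⟨0, ?_, ?_⟩
        · rw [ho, add_zero]
          congr 1
          funext x
          exact (hI₂.mem_four x).symm
        · simp [State.reg_setReg, State.mem_setReg, hI₂.reg_seven, needCount, hI₂.mem_four]
      · simp [State.mem_setReg, hI₂.mem_four]
      · simpa [State.reg_setReg] using hI₂.reg_zero
      · simpa [State.reg_setReg] using hI₂.reg_one
      · simpa [State.reg_setReg] using hI₂.reg_nine
      all_goals simp [State.reg_setReg]
      intro i _ h h'
      exact absurd h h')
  obtain ⟨t₄, ht₄, s₄, hx₄, hge₄, -, G, hI₄, -⟩ := exists_exec_whileLt (b := b) (x := 2) (y := 0)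
    (P := stripStep) (I := fun k s => ∃ G : SimpleGraph (Fin n),
      IsStripping T.edgeDominationNumber G s ∧ k = (n - s.reg 2) + G.edgeSet.ncard)
    (by
      rintro k s ⟨G, hG, rfl⟩ hlt
      refine Prog.wp_mono _ ?_ (hG.wp_stripStep hlt hon hb)
      rintro s' ⟨H, hH, hk⟩
      exact ⟨_, hk, H, hH, rfl⟩) _ ⟨T, hI₃, rfl⟩
  have h7 := hI₄.reg_seven_eq hge₄
  obtain ⟨t₅, ht₅, s₅, hx₅, hr₅⟩ := Prog.exists_exec_of_wp (b := b) (.add 0 7 9)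
    (Q := fun s => s.reg 0 = T.edgeDominationNumber) (s := s₄) (by
      simp only [Prog.wp, State.reg_setReg, h7, hI₄.reg_nine]
      simp
      omega)
  refine ⟨_, s₅, .seq hx₁ (.seq hx₂ (.seq hx₃ (.seq hx₄ hx₅))), ?_, hr₅⟩
  have e₂ : enterEdge.time = 15 := rfl
  have e₄ : stripStep.time ≤ 30 := by decide
  have hk := hl.length_eq
  -- The second loop starts with potential `n + (n - 1)` and each round costs at most 31 steps with
  -- its test; a round of the first loop costs 16. The total stays below `100 * n`.
  have hm := Nat.mul_le_mul_left (n + l.length) (Nat.succ_le_succ e₄)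
  rw [e₂] at ht₂
  rw [hr₃, ← hk, Nat.sub_zero] at ht₄
  simp only [Prog.time] at ht₁ ht₃ ht₅
  have : (l.length - s₁.reg 2) * 16 ≤ l.length * 16 := Nat.mul_le_mul_right _ (Nat.sub_le _ _)
  simp only [Nat.succ_eq_add_one] at hm
  omega

theorem word_bound {n : ℕ} (hn : 1 ≤ n) : n * n + 2 * n + 2 < 2 ^ (100 * Nat.size n) := by
  have h1 : n < 2 ^ n.size := Nat.lt_size_self n
  have h2 : 1 ≤ n.size := Nat.size_pos.2 hn
  calc n * n + 2 * n + 2 < 2 ^ n.size * 2 ^ n.size * 2 ^ 3 := by nlinarith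
    _ = 2 ^ (2 * n.size + 3) := by ring
    _ ≤ 2 ^ (100 * n.size) := Nat.pow_le_pow_right (by norm_num) (by omega)

end WordRAM

theorem mainTheorem5 :
    (∀ (V : Type*) [Finite V] (G : SimpleGraph V), G.IsTree →
      IsLeast {k | G.IsKUnigraph k} G.unigraphNumber ∧
      G.unigraphNumber = G.edgeDominationNumber) ∧
    ∃ (P : WordRAM.Prog) (C : ℕ),
      ∀ (n : ℕ) (T : SimpleGraph (Fin n)), T.IsTree →
      ∀ l : List (Fin n × Fin n), T.IsEdgeList l →
        ∃ (t : ℕ) (s : WordRAM.State),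
          WordRAM.Exec (C * Nat.size n) P (WordRAM.input n l) t s ∧
          t ≤ C * n ∧ s.reg 0 = T.unigraphNumber := by
  refine ⟨fun V _ G hG => ⟨hG.isAcyclic.isLeast_unigraphNumber, hG.isAcyclic.unigraphNumber_eq⟩,
    WordRAM.treeEdgeDomination, 100, fun n T hT l hl => ?_⟩
  -- Trees are nonempty; for `n = 0` words would have no bits.
  have hn : 1 ≤ n := by
    obtain ⟨x⟩ := hT.connected.nonempty
    exact Nat.one_le_of_lt x.2
  rw [hT.isAcyclic.unigraphNumber_eq]
  exact WordRAM.exists_exec_treeEdgeDomination hT hl (WordRAM.word_bound hn)
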